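/- Work over $\mathbb{C}$. For a smooth point $x$ of a projective variety $X \subseteq \mathbb{P}^r$ of dimension $n$ (with $n = \dim X$), let $\varphi : U \subseteq \mathbb{C}^n \to \mathbb{C}^{r+1}\setminus\{0\}$ be a holomorphic lifting of a local parametrization of $X$ centered in $x$ (so $[\varphi(0)] = x$). The $m$-osculating space $T^m_x(X)$ is the projective subspace of $\mathbb{P}^r$ spanned by the partial derivatives $\frac{\partial^{|I|}\varphi}{\partial t^{I}}(0)$ with $|I| \le m$. Let $r, h, m \ge 0$ be integers with $m \ge 1$ or $h = 0$, and let $X_0, \ldots, X_h \subseteq \mathbb{P}^r$ be integral projective varieties, none of which is contained in a hyperplane. Let $$J := \overline{\bigcup_{p_i \in X_i} \langle p_0, \ldots, p_h\rangle} \subseteq \mathbb{P}^r$$ (Zariski closure) be their join. Then for general $p_i \in X_i$ $(i = 0, \ldots, h)$ and general $p \in \langle p_0, \ldots, p_h \rangle$, the point $p$ is a smooth point of $J$, each $p_i$ is a smooth point of $X_i$, and $$T^m_p(J) = \langle T^m_{p_0}(X_0), \ldots, T^m_{p_h}(X_h) \rangle .$$ Here "general" means: there is a nonempty Zariski open subset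 $U$ of $X_0 \times \cdots \times X_h$ such that for every $(p_0,\ldots,p_h) \in U$ there is a nonempty Zariski open subset $V$ of $\langle p_0, \ldots, p_h\rangle$ such that the assertion holds for every $p \in V$. -/

import Mathlib

open scoped Topology LinearAlgebra.Projectivization

namespace Join

/-- Complex projective `r`-space, as the set of lines through the origin of `ℂ^(r+1)`. -/
abbrev PSpace (r : ℕ) : Type := ℙ ℂ (Fin (r + 1) → ℂ)

/-- The Zariski topology on `P^r`: a basis of open sets is given by the complements of the
hypersurfaces `f = 0`, with `f` a homogeneous polynomial. (The vanishing of a homogeneous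
polynomial does not depend on the representative.) -/
@[reducible] def zariski (r : ℕ) : TopologicalSpace (PSpace r) :=
  TopologicalSpace.generateFrom
    {U | ∃ (d : ℕ) (f : MvPolynomial (Fin (r + 1)) ℂ), f.IsHomogeneous d ∧
      U = {x | MvPolynomial.eval x.rep f ≠ 0}}

/-- The Zariski topology on the product variety `∏_{i ∈ ι} P^r`: a basis of open sets is given by
the complements of the zero sets of multihomogeneous polynomials. The variable `(i, j)` is the
`j`-th homogeneous coordinate on the `i`-th factor, and its multidegree is the `i`-th unit vector
of `ℕ^ι`. -/
@[reducible] def multiZariski (ι : Type) [DecidableEq ι] (r : ℕ) : TopologicalSpace (ι → PSpace r) :=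
  TopologicalSpace.generateFrom
    {U | ∃ (d : ι → ℕ) (f : MvPolynomial (ι × Fin (r + 1)) ℂ),
      f.IsWeightedHomogeneous (fun k : ι × Fin (r + 1) => (Pi.single k.1 1 : ι → ℕ)) d ∧
      U = {x | MvPolynomial.eval (fun k : ι × Fin (r + 1) => (x k.1).rep k.2) f ≠ 0}}

/-- An integral (that is, reduced and irreducible) non-degenerate projective variety in `P^r`, given
by its set of complex points: a Zariski closed, irreducible (in particular nonempty) subset which
lies in no proper projective subspace. -/
structure IsNondegenerateVariety {r : ℕ} (X : Set (PSpace r)) : Prop where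
  isClosed : IsClosed[zariski r] X
  isIrreducible : @IsIrreducible _ (zariski r) X
  span_eq_top : ⨆ x ∈ X, x.submodule = ⊤

/-- The span `⟨p_i : i ∈ ι⟩` of a family of points of `P^r`. A projective subspace of `P^r` is given
throughout by the corresponding linear subspace of `ℂ^(r+1)`. -/
noncomputable def pointSpan {r : ℕ} {ι : Type} (p : ι → PSpace r) : Submodule ℂ (Fin (r + 1) → ℂ) :=
  ⨆ i, (p i).submodule

/-- The set of points of the projective subspace given by the linear subspace `L`. -/
def projPoints {r : ℕ} (L : Submodule ℂ (Fin (r + 1) → ℂ)) : Set (PSpace r) :=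
  {x | x.submodule ≤ L}

/-- The join of a family of subsets of `P^r`: the Zariski closure of the union of the spans
`⟨p_i : i ∈ ι⟩`, over all choices of points `p_i ∈ X_i`. -/
def join {r : ℕ} {ι : Type} (X : ι → Set (PSpace r)) : Set (PSpace r) :=
  @closure _ (zariski r) (⋃ p ∈ Set.univ.pi X, projPoints (pointSpan p))

/-- The nonzero vectors of `ℂ^(r+1)` which represent a point of `X`. -/
def coneOf {r : ℕ} (X : Set (PSpace r)) : Set (Fin (r + 1) → ℂ) :=
  {v | ∃ hv : v ≠ 0, Projectivization.mk ℂ v hv ∈ X}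

/-- `φ` is (the germ at the origin of `ℂⁿ` of) a lifting to `ℂ^(r+1) \ {0}` of a local
parametrization of `X` centered in `x`. That is, `φ` is holomorphic near `0`, and `t ↦ [φ t]` maps
`0` to `x`, is immersive at `0`, and maps small neighbourhoods of `0` into `X` and onto
neighbourhoods of `x` in `X` (for the classical topology, which is expressed through representatives
in `ℂ^(r+1) \ {0}`). Such a `φ` exists if and only if `X` is a complex submanifold of dimension `n`
near `x`. -/
structure IsLocalParametrization {r : ℕ} (X : Set (PSpace r)) (x : PSpace r) (n : ℕ)
    (φ : (Fin n → ℂ) → (Fin (r + 1) → ℂ)) : Prop where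
  analyticAt : AnalyticAt ℂ φ 0
  center : ∃ h0 : φ 0 ≠ 0, Projectivization.mk ℂ (φ 0) h0 = x
  immersive : ∀ u : Fin n → ℂ, fderiv ℂ φ 0 u ∈ Submodule.span ℂ {φ 0} → u = 0
  mem : ∀ᶠ t in 𝓝 (0 : Fin n → ℂ), φ t ∈ coneOf X
  onto : ∀ U ∈ 𝓝 (0 : Fin n → ℂ), ∀ᶠ w in 𝓝 (φ 0), w ∈ coneOf X → ∃ t ∈ U, ∃ c : ℂ, w = c • φ t

/-- `x` is a smooth point of `X`: near `x`, the set `X` is a complex submanifold of `P^r`, i.e. it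
has a local parametrization centered in `x`. -/
def IsSmoothPoint {r : ℕ} (X : Set (PSpace r)) (x : PSpace r) : Prop :=
  ∃ (n : ℕ) (φ : (Fin n → ℂ) → (Fin (r + 1) → ℂ)), IsLocalParametrization X x n φ

/-- The span of all partial derivatives of `φ` of order at most `m` at the origin. The partial
derivative of order `k` with respect to `t_{i 0}, …, t_{i (k-1)}` is the `k`-th Fréchet derivative
evaluated at the corresponding coordinate vectors. -/
def derivSpan {r n : ℕ} (m : ℕ) (φ : (Fin n → ℂ) → (Fin (r + 1) → ℂ)) :
    Submodule ℂ (Fin (r + 1) → ℂ) :=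
  Submodule.span ℂ {w | ∃ k ≤ m, ∃ i : Fin k → Fin n,
    w = iteratedFDeriv ℂ k φ 0 (fun j => Pi.single (i j) 1)}

/-- `L` is the `m`-osculating space to `X` at `x`: it is spanned by the partial derivatives of order
at most `m` at the origin of a lifted local parametrization of `X` centered in `x`. -/
def IsOsculatingSpace {r : ℕ} (m : ℕ) (X : Set (PSpace r)) (x : PSpace r)
    (L : Submodule ℂ (Fin (r + 1) → ℂ)) : Prop :=
  ∃ (n : ℕ) (φ : (Fin n → ℂ) → (Fin (r + 1) → ℂ)),
    IsLocalParametrization X x n φ ∧ L = derivSpan m φ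

end Join

/-!
Everything takes place on affine cones. Let `Z` be the product of the cones over the `Xᵢ` and
`W` the cone over the join; addition of vectors maps `Z` into `W`, and the ideal of `W` is the
preimage of the ideal of `Z` (`comap_vanishingIdeal_blockProd`), so the map is dominant. In
characteristic zero a dominant map of integral affine varieties is generically smooth. Near a
general point `z` of `Z`, the inverse function theorem turns this into an analytic product
structure of `Z` over `W` (`exists_local_product_structure`); in particular addition has an
analytic local section through `z`. This is what makes the osculating space of the join no larger
than expected. The same structure theorem, applied to one homogeneous coordinate on the cone over
a single variety, shows that a general point of the variety is smooth
(`exists_isSmoothPoint_of_aeval_ne_zero`).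

Osculating spaces are compared through their annihilators: a linear form `l` kills the partial
derivatives of order at most `m` of a lifting `φ` if and only if `l ∘ φ = O(‖t‖ ^ (m + 1))`
(`forall_derivSpan_eq_zero_iff`). If `φ` lifts a local parametrization of `X`, this order of
vanishing passes to every differentiable family in the cone over `X` with the same centre
(`IsLocalParametrization.isBigO_of_mem_coneOf`). Now let `w = ∑ zᵢ` be a general vector of `W`.

* The cone over the join contains `w - zᵢ + u` for all `u` in the cone over `Xᵢ`. A form that
  vanishes to order `m + 1` along the join hence does so along each `Xᵢ` (`iSup_derivSpan_le`); for
  the constant term one needs `m ≥ 1`, or that there is a single variety.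
* Composing a parametrization of the join with the local section of addition writes it as a sum of
  families in the cones over the `Xᵢ`. A form that vanishes to order `m + 1` along each `Xᵢ` hence
  does so along the join (`derivSpan_le_iSup`).

It remains to express genericity through multihomogeneous polynomials in the `pᵢ` and homogeneous
polynomials on their span, starting from one polynomial which does not vanish identically on `Z`
(`exists_generic_decomposition`).
-/

namespace Join

open MvPolynomial Algebra Filter Asymptotics

/-! ### Annihilators of osculating spaces -/

/-- An analytic function vanishes to order `m + 1` if and only if its derivatives of order at most
`m` vanish. -/
theorem isBigO_pow_iff_iteratedFDeriv_eq_zero {E F : Type*} [NormedAddCommGroup E]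
    [NormedSpace ℂ E] [NormedAddCommGroup F] [NormedSpace ℂ F] [CompleteSpace F] {f : E → F}
    (hf : AnalyticAt ℂ f 0) (m : ℕ) :
    (f =O[𝓝 0] fun t => ‖t‖ ^ (m + 1)) ↔ ∀ k ≤ m, iteratedFDeriv ℂ k f 0 = 0 := by
  obtain ⟨p, r, hp⟩ := hf
  have hrem : (fun y => f y - p.partialSum (m + 1) y) =O[𝓝 0] fun y => ‖y‖ ^ (m + 1) := by
    simpa using hp.hasFPowerSeriesAt.isBigO_sub_partialSum_pow (m + 1)
  constructor
  · intro h
    have hdiag : ∀ k ≤ m, ∀ y, p k (fun _ => y) = 0 := by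
      intro k
      induction k using Nat.strong_induction_on with
      | _ k ih =>
        intro hk
        have hsum : p.partialSum (k + 1) = fun y => p k fun _ => y := by
          funext z
          refine Finset.sum_eq_single _ (fun b hb hnb => ?_) fun hn => ?_
          · have := Finset.mem_range_succ_iff.mp hb
            exact ih b (this.lt_of_ne hnb) (by omega) z
          · exact False.elim (hn (Finset.mem_range.mpr (lt_add_one k)))
        have h1 : (fun y => f y - p.partialSum (k + 1) y) =O[𝓝 0] fun y => ‖y‖ ^ (k + 1) := by
          simpa using hp.hasFPowerSeriesAt.isBigO_sub_partialSum_pow (k + 1)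
        have h2 : f =O[𝓝 0] fun y => ‖y‖ ^ (k + 1) :=
          h.trans (IsBigO.of_bound 1 (by
            filter_upwards [Metric.ball_mem_nhds (0 : E) one_pos] with y hy
            have hy1 : ‖y‖ ≤ 1 := (mem_ball_zero_iff.1 hy).le
            simpa using pow_le_pow_of_le_one (norm_nonneg y) hy1 (by omega : k + 1 ≤ m + 1)))
        have h3 : (fun y => p k fun _ => y) =O[𝓝 0] fun y => ‖y‖ ^ (k + 1) := by
          rw [← hsum]
          simpa using h2.sub h1
        exact h3.continuousMultilinearMap_apply_eq_zero
    intro k hk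
    -- Terms vanishing on the diagonal may be removed from the power series; the symmetrization
    -- formula for the derivatives then gives the claim without polarization.
    let q : FormalMultilinearSeries ℂ E F := fun j => if j ≤ m then 0 else p j
    have hq : HasFPowerSeriesOnBall f q 0 r := by
      refine ⟨hp.r_le.trans (FormalMultilinearSeries.radius_le_of_le fun j => ?_), hp.r_pos, ?_⟩
      · by_cases hj : j ≤ m <;> simp [q, hj]
      · intro y hy
        convert hp.hasSum hy using 2 with j
        by_cases hj : j ≤ m <;> simp [q, hj, hdiag j]
    ext v
    rw [hq.iteratedFDeriv_eq_sum_of_completeSpace]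
    simp [q, hk]
  · intro h
    have : p.partialSum (m + 1) = 0 := by
      funext y
      refine Finset.sum_eq_zero fun k hk => ?_
      have h1 := hp.factorial_smul y k
      rw [h k (by simpa [Nat.lt_succ_iff] using hk)] at h1
      rw [← Nat.cast_smul_eq_nsmul ℂ] at h1
      simpa [Nat.factorial_ne_zero] using h1
    simpa [this] using hrem

/-- The annihilator of the osculating space, described by orders of vanishing. -/
theorem forall_derivSpan_eq_zero_iff {r n : ℕ} (m : ℕ) {φ : (Fin n → ℂ) → (Fin (r + 1) → ℂ)}
    (hφ : AnalyticAt ℂ φ 0) (l : (Fin (r + 1) → ℂ) →L[ℂ] ℂ) :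
    (∀ w ∈ derivSpan m φ, l w = 0) ↔ (fun t => l (φ t)) =O[𝓝 0] fun t => ‖t‖ ^ (m + 1) := by
  have hl : AnalyticAt ℂ (fun t => l (φ t)) 0 := (l.analyticAt _).comp hφ
  rw [isBigO_pow_iff_iteratedFDeriv_eq_zero hl]
  have key : ∀ k, iteratedFDeriv ℂ k (fun t => l (φ t)) 0 =
      l.compContinuousMultilinearMap (iteratedFDeriv ℂ k φ 0) := fun k =>
    l.iteratedFDeriv_comp_left (hφ.contDiffAt (n := ⊤)) (by exact_mod_cast le_top)
  constructor
  · intro h k hk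
    rw [key]
    apply ContinuousMultilinearMap.toMultilinearMap_injective
    refine Module.Basis.ext_multilinear (fun _ => Pi.basisFun ℂ (Fin n)) fun v => ?_
    simpa using h _ (Submodule.subset_span ⟨k, hk, v, rfl⟩)
  · intro h w hw
    have : derivSpan m φ ≤ LinearMap.ker (l : (Fin (r + 1) → ℂ) →ₗ[ℂ] ℂ) := by
      refine Submodule.span_le.2 ?_
      rintro _ ⟨k, hk, i, rfl⟩
      have := congrArg (fun L => L fun j => Pi.single (i j) 1) ((key k).symm.trans (h k hk))
      simpa using this
    exact this hw

theorem le_of_forall_clm {r : ℕ} {S T : Submodule ℂ (Fin (r + 1) → ℂ)}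
    (h : ∀ l : (Fin (r + 1) → ℂ) →L[ℂ] ℂ, (∀ w ∈ T, l w = 0) → ∀ w ∈ S, l w = 0) : S ≤ T := by
  intro w hw
  by_contra hwT
  obtain ⟨l, hl, hT⟩ := Submodule.exists_le_ker_of_notMem hwT
  exact hl (h l.toContinuousLinearMap (fun u hu => hT hu) w hw)

theorem smul_mem_coneOf {r : ℕ} {X : Set (PSpace r)} {v : Fin (r + 1) → ℂ} (hv : v ∈ coneOf X)
    {c : ℂ} (hc : c ≠ 0) : c • v ∈ coneOf X := by
  obtain ⟨h0, hX⟩ := hv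
  refine ⟨smul_ne_zero hc h0, ?_⟩
  convert hX using 1
  exact (Projectivization.mk_eq_mk_iff' ..).2 ⟨c, rfl⟩

/-- If a linear form vanishes to order `m + 1` along a lifted local parametrization of `X`, it
does so along every differentiable family in the cone over `X` with the same centre. Indeed such a
family is, up to scalars, a reparametrization `φ ∘ u` with `u = O(t)`, since `φ` is immersive and
onto. -/
theorem IsLocalParametrization.isBigO_of_mem_coneOf {r n k : ℕ} {X : Set (PSpace r)}
    {x : PSpace r} {φ : (Fin n → ℂ) → (Fin (r + 1) → ℂ)} (hφ : IsLocalParametrization X x n φ)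
    {χ : (Fin k → ℂ) → (Fin (r + 1) → ℂ)} (hχ : DifferentiableAt ℂ χ 0) {a : ℂ} (ha : a ≠ 0)
    (h0 : χ 0 = a • φ 0) (hmem : ∀ᶠ t in 𝓝 0, χ t ∈ coneOf X) {m : ℕ}
    (l : (Fin (r + 1) → ℂ) →L[ℂ] ℂ)
    (hl : (fun t => l (φ t)) =O[𝓝 0] fun t => ‖t‖ ^ (m + 1)) :
    (fun t => l (χ t)) =O[𝓝 0] fun t => ‖t‖ ^ (m + 1) := by
  obtain ⟨hφ0, -⟩ := hφ.center
  obtain ⟨j, hj⟩ := Function.ne_iff.1 hφ0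
  simp only [Pi.zero_apply] at hj
  let e : (Fin (r + 1) → ℂ) →L[ℂ] ℂ :=
    (φ 0 j)⁻¹ • (ContinuousLinearMap.proj j : (Fin (r + 1) → ℂ) →L[ℂ] ℂ)
  have he : e (φ 0) = 1 := by simp [e, hj]
  -- `N` divides a vector by its `e`-coordinate; it depends on the line through the vector only
  let N : (Fin (r + 1) → ℂ) → (Fin (r + 1) → ℂ) := fun v => (e v)⁻¹ • v
  have hN : HasFDerivAt N
      (ContinuousLinearMap.id ℂ _ - e.smulRight (φ 0)) (φ 0) := by
    have h1 : HasFDerivAt (fun v => (e v)⁻¹) (-e) (φ 0) := by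
      refine ((hasDerivAt_inv (x := e (φ 0)) (by simp [he])).comp_hasFDerivAt (φ 0)
        e.hasFDerivAt).congr_fderiv ?_
      ext v
      simp [he]
    refine (h1.smul (hasFDerivAt_id (φ 0))).congr_fderiv ?_
    ext v
    simp [he, sub_eq_add_neg]
  have hNφ : HasFDerivAt (fun t => N (φ t))
      ((ContinuousLinearMap.id ℂ _ - e.smulRight (φ 0)).comp (fderiv ℂ φ 0)) 0 :=
    hN.comp 0 hφ.analyticAt.differentiableAt.hasFDerivAt
  -- Immersivity: the parameter `t` is controlled by the point `N (φ t)`.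
  have hrev : (fun t => t - 0) =O[𝓝 (0 : Fin n → ℂ)] fun t => N (φ t) - N (φ 0) := by
    obtain ⟨K, -, hK⟩ := LinearMap.exists_antilipschitzWith
      (((ContinuousLinearMap.id ℂ (Fin (r + 1) → ℂ) - e.smulRight (φ 0)).comp
        (fderiv ℂ φ 0) : (Fin n → ℂ) →L[ℂ] (Fin (r + 1) → ℂ)) :
          (Fin n → ℂ) →ₗ[ℂ] (Fin (r + 1) → ℂ)) (by
        rw [LinearMap.ker_eq_bot']
        intro u hu
        refine hφ.immersive u (Submodule.mem_span_singleton.2 ⟨e (fderiv ℂ φ 0 u), ?_⟩)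
        simp only [ContinuousLinearMap.coe_coe, ContinuousLinearMap.comp_apply,
          sub_apply, ContinuousLinearMap.id_apply,
          ContinuousLinearMap.smulRight_apply, sub_eq_zero] at hu
        exact hu.symm)
    exact (hNφ.isTheta_sub
      (hK.isUniformInducing (ContinuousLinearMap.uniformContinuous _)).isInducing).2
  have hNl : (fun t => l (N (φ t))) =O[𝓝 0] fun t => ‖N (φ t) - N (φ 0)‖ ^ (m + 1) := by
    have hbd : (fun t => (e (φ t))⁻¹) =O[𝓝 0] fun _ => (1 : ℝ) := by
      have : ContinuousAt (fun t => (e (φ t))⁻¹) 0 :=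
        (e.continuous.continuousAt.comp hφ.analyticAt.continuousAt).inv₀ (by simp [he])
      exact this.isBigO_one ℝ
    have h1 := hbd.mul hl
    have h2 : (fun t : Fin n → ℂ => ‖t‖ ^ (m + 1)) =O[𝓝 0]
        fun t => ‖N (φ t) - N (φ 0)‖ ^ (m + 1) := by
      simpa using (hrev.norm_norm.pow (m + 1))
    refine IsBigO.trans ?_ h2
    simpa only [N, map_smul, smul_eq_mul, one_mul] using h1
  obtain ⟨C, hC⟩ := hNl.bound
  have hev : ∀ᶠ t in 𝓝 (0 : Fin n → ℂ), e (φ t) ≠ 0 :=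
    (e.continuous.continuousAt.comp hφ.analyticAt.continuousAt).eventually_ne (by simp [he])
  have honto := hφ.onto _ (hC.and hev)
  have hlim : Tendsto (fun t => a⁻¹ • χ t) (𝓝 0) (𝓝 (φ 0)) := by
    have := hχ.continuousAt.tendsto.const_smul a⁻¹
    rwa [h0, inv_smul_smul₀ ha] at this
  have heχ : ∀ᶠ t in 𝓝 (0 : Fin k → ℂ), e (a⁻¹ • χ t) ≠ 0 :=
    ((e.continuous.tendsto _).comp hlim).eventually_ne (by simp [he])
  have hdist : (fun t => N (a⁻¹ • χ t) - N (φ 0)) =O[𝓝 0] fun t => t := by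
    have hd : DifferentiableAt ℂ (fun t => N (a⁻¹ • χ t)) 0 := by
      refine DifferentiableAt.comp (0 : Fin k → ℂ) (g := N) ?_ (hχ.const_smul a⁻¹)
      rw [h0, inv_smul_smul₀ ha]
      exact hN.differentiableAt
    have := hd.isBigO_sub
    simpa [h0, inv_smul_smul₀ ha] using this
  have hmain : (fun t => l (N (a⁻¹ • χ t))) =O[𝓝 0] fun t => ‖t‖ ^ (m + 1) := by
    have h1 : (fun t => l (N (a⁻¹ • χ t))) =O[𝓝 0]
        fun t => ‖N (a⁻¹ • χ t) - N (φ 0)‖ ^ (m + 1) := by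
      refine IsBigO.of_bound C ?_
      filter_upwards [hlim.eventually honto, hmem, heχ] with t ht htX het
      obtain ⟨u, ⟨hu, heu⟩, c, hc⟩ := ht (smul_mem_coneOf htX (inv_ne_zero ha))
      have hc0 : c ≠ 0 := by
        rintro rfl
        simp [hc] at het
      have hNu : N (a⁻¹ • χ t) = N (φ u) := by
        simp only [N, hc, map_smul, smul_eq_mul, mul_inv, smul_smul]
        congr 1
        field_simp
      rw [hNu]
      exact hu
    refine h1.trans ?_
    simpa using hdist.norm_norm.pow (m + 1)
  have hbd : (fun t => a * e (a⁻¹ • χ t)) =O[𝓝 0] fun _ => (1 : ℝ) :=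
    (((e.continuous.tendsto _).comp hlim).const_mul a).isBigO_one ℝ
  have := hbd.mul hmain
  simp only [one_mul] at this
  refine this.congr' ?_ EventuallyEq.rfl
  filter_upwards [heχ] with t ht
  have : χ t = (a * e (a⁻¹ • χ t)) • N (a⁻¹ • χ t) := by
    simp only [N]
    rw [smul_smul, mul_assoc, mul_inv_cancel₀ ht, mul_one, smul_inv_smul₀ ha]
  conv_rhs => rw [this, map_smul, smul_eq_mul]

/-! ### Generic smoothness and presentations -/

/-- Generic smoothness in characteristic zero: the extension of fraction fields is separable, so the
generic point of `Spec A` is a smooth point over `B`. -/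
theorem exists_isStandardSmooth_away (B A : Type*) [CommRing B] [IsDomain B] [CharZero B]
    [IsNoetherianRing B] [CommRing A] [IsDomain A] [Algebra B A] [FaithfulSMul B A]
    [Algebra.FiniteType B A] :
    ∃ f : A, f ≠ 0 ∧ Algebra.IsStandardSmooth B (Localization.Away f) := by
  have : Algebra.FinitePresentation B A := Algebra.FinitePresentation.of_finiteType.1 inferInstance
  let K := FractionRing B
  let L := Localization.AtPrime (⊥ : Ideal A)
  have hL : IsFractionRing A L := by
    have h : (⊥ : Ideal A).primeCompl = nonZeroDivisors A := by
      ext x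
      simp [Ideal.primeCompl, mem_nonZeroDivisors_iff_ne_zero]
    rw [IsFractionRing, ← h]
    exact Localization.isLocalization
  let : Field L := IsFractionRing.toField A
  have : FaithfulSMul B L := FaithfulSMul.trans B A L
  let : Algebra K L := FractionRing.liftAlgebra B L
  have : IsScalarTower B K L := FractionRing.isScalarTower_liftAlgebra B L
  have : CharZero K := charZero_of_injective_algebraMap (IsFractionRing.injective B K)
  have : Algebra.EssFiniteType A L := .of_isLocalization L (nonZeroDivisors A)
  have : Algebra.EssFiniteType B L := .comp B A L
  have : Algebra.EssFiniteType K L := .of_comp B K L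
  have : Algebra.FormallySmooth B K := .of_isLocalization (nonZeroDivisors B)
  have : Algebra.IsSmoothAt B (⊥ : Ideal A) := Algebra.FormallySmooth.comp B K L
  obtain ⟨f, hf, h⟩ := Algebra.IsSmoothAt.exists_notMem_isStandardSmooth B (⊥ : Ideal A)
  exact ⟨f, by simpa using hf, h⟩

theorem hasFDerivAt_aeval {τ : Type*} [Fintype τ] (F : MvPolynomial τ ℂ) (v : τ → ℂ) :
    HasFDerivAt (fun v : τ → ℂ => aeval v F)
      (∑ i, aeval v (pderiv i F) • (ContinuousLinearMap.proj i : (τ → ℂ) →L[ℂ] ℂ)) v := by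
  classical
  induction F using MvPolynomial.induction_on with
  | C a =>
    simp only [algHom_C, Algebra.algebraMap_self, RingHom.id_apply]
    refine (hasFDerivAt_const a v).congr_fderiv ?_
    ext u
    simp
  | add p q hp hq =>
    simp only [map_add]
    refine (hp.add hq).congr_fderiv ?_
    ext u
    simp [add_mul, Finset.sum_add_distrib]
  | mul_X p n hp =>
    simp only [map_mul, aeval_X]
    refine (hp.mul (hasFDerivAt_apply n v)).congr_fderiv ?_
    ext u
    simp [pderiv_X, Pi.single_apply, Finset.mul_sum, mul_add, Finset.sum_add_distrib,
      mul_left_comm, mul_comm, apply_ite]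

section

variable {ι σ κ : Type*} {B S : Type*} [CommRing B] [Algebra ℂ B]

/-- Substitutes elements `b` of `B` for the second group of variables of a polynomial. -/
noncomputable def substCoeff (b : κ → B) : MvPolynomial (ι ⊕ κ) ℂ →ₐ[ℂ] MvPolynomial ι B :=
  aeval (Sum.elim X fun k => C (b k))

theorem pderiv_substCoeff (b : κ → B) (i : ι) (F : MvPolynomial (ι ⊕ κ) ℂ) :
    pderiv i (substCoeff b F) = substCoeff b (pderiv (Sum.inl i) F) := by
  classical
  induction F using MvPolynomial.induction_on with
  | C a => simp [substCoeff, MvPolynomial.algebraMap_apply]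
  | add p q hp hq => simp only [map_add, hp, hq]
  | mul_X p n hp =>
    simp only [map_mul, Derivation.leibniz, hp, smul_eq_mul, map_add]
    congr 2
    rcases n with n | n
    · by_cases h : i = n
      · subst h; simp [substCoeff]
      · simp [substCoeff, h, pderiv_X]
    · simp [substCoeff, pderiv_X]

theorem substCoeff_surjective {b : κ → B}
    (hb : Function.Surjective (aeval b : MvPolynomial κ ℂ →ₐ[ℂ] B)) :
    Function.Surjective (substCoeff (ι := ι) b) := by
  intro F
  change F ∈ (substCoeff (ι := ι) b).range
  induction F using MvPolynomial.induction_on with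
  | C a =>
    obtain ⟨p, rfl⟩ := hb a
    refine ⟨rename Sum.inr p, ?_⟩
    change substCoeff b (rename Sum.inr p) = _
    simp only [substCoeff, aeval_rename]
    induction p using MvPolynomial.induction_on with
    | C a => simp [MvPolynomial.algebraMap_apply]
    | add p q hp hq => simp only [map_add, hp, hq]
    | mul_X p n hp => simp only [map_mul, hp, aeval_X, Function.comp_apply, Sum.elim_inr]
  | add p q hp hq => exact add_mem hp hq
  | mul_X p n hp => exact mul_mem hp ⟨X (Sum.inl n), by simp [substCoeff]⟩

/-- A complex point `β` of `B` together with values of the first group of variables evaluates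
`substCoeff b F` like the corresponding point of affine space evaluates `F`. -/
theorem eval₂Hom_substCoeff (b : κ → B) (β : B →ₐ[ℂ] ℂ) (v : ι ⊕ κ → ℂ)
    (hv : ∀ k, β (b k) = v (Sum.inr k)) (F : MvPolynomial (ι ⊕ κ) ℂ) :
    eval₂Hom (β : B →+* ℂ) (v ∘ Sum.inl) (substCoeff b F) = aeval v F := by
  induction F using MvPolynomial.induction_on with
  | C a => simp [substCoeff, MvPolynomial.algebraMap_apply]
  | add p q hp hq => simp only [map_add, hp, hq]
  | mul_X p n hp =>
    simp only [map_mul, hp]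
    rcases n with n | n <;> simp [substCoeff, hv]

variable [CommRing S] [Algebra ℂ S] [Algebra B S] [IsScalarTower ℂ B S]

theorem algHom_aeval_substCoeff (b : κ → B) (c : ι → S) (θ : S →ₐ[ℂ] ℂ)
    (F : MvPolynomial (ι ⊕ κ) ℂ) :
    θ (aeval c (substCoeff b F)) =
      aeval (fun k => θ (Sum.elim c (fun k => algebraMap B S (b k)) k)) F := by
  induction F using MvPolynomial.induction_on with
  | C a =>
    simp [substCoeff, MvPolynomial.algebraMap_apply, ← IsScalarTower.algebraMap_apply ℂ B S]
  | add p q hp hq => simp only [map_add, hp, hq]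
  | mul_X p n hp =>
    simp only [map_mul, hp]
    rcases n with n | n <;> simp [substCoeff]

/-- A complex point `β` of `B` and a common zero `y` of the relations over `β` define a complex
point of the presented algebra. -/
theorem exists_algHom_of_relation (P : Presentation B S ι σ) (β : B →ₐ[ℂ] ℂ) (y : ι → ℂ)
    (h : ∀ j, eval₂Hom (β : B →+* ℂ) y (P.relation j) = 0) :
    ∃ θ : S →ₐ[ℂ] ℂ, (∀ a, θ (algebraMap B S a) = β a) ∧ ∀ i, θ (P.val i) = y i := by
  have hker : RingHom.ker (aeval P.val : MvPolynomial ι B →ₐ[B] S).toRingHom ≤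
      RingHom.ker (eval₂Hom (β : B →+* ℂ) y) := by
    have : P.ker ≤ RingHom.ker (eval₂Hom (β : B →+* ℂ) y) := by
      rw [← P.span_range_relation_eq_ker, Ideal.span_le]
      rintro _ ⟨j, rfl⟩
      exact h j
    intro x hx
    refine this ?_
    rw [P.ker_eq_ker_aeval_val]
    exact hx
  let g := (aeval P.val : MvPolynomial ι B →ₐ[B] S).toRingHom.liftOfSurjective
    P.aeval_val_surjective ⟨eval₂Hom (β : B →+* ℂ) y, hker⟩
  have hg : ∀ x, g (aeval P.val x) = eval₂Hom (β : B →+* ℂ) y x := fun x =>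
    RingHom.liftOfRightInverse_comp_apply _ _ _ ⟨eval₂Hom (β : B →+* ℂ) y, hker⟩ x
  have hgB : ∀ a, g (algebraMap B S a) = β a := fun a => by simpa using hg (C a)
  refine ⟨{ g with commutes' := fun a => ?_ }, hgB, fun i => by simpa using hg (X i)⟩
  have := hgB (algebraMap ℂ B a)
  rw [← IsScalarTower.algebraMap_apply] at this
  simpa using this

end

/-! ### Analytic lifting along a submersive presentation -/

/-- Let `S` have a submersive presentation over `B`, where `B` is generated by the `b k`. Near a
complex point `θ₀` of `S`, a complex point of `S` amounts to a complex point of `B` and values of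
the generators that are not attached to a relation, and it depends on these analytically through
`Ψ`. This is the inverse function theorem; the Jacobian of the presentation provides the
invertible derivative. Points are recorded by the values of the generators of `S` and `B`. -/
theorem exists_analytic_local_lift {ι σ κ : Type} [Fintype ι] [Finite σ] [Fintype κ] {B S : Type*}
    [CommRing B] [Algebra ℂ B] [CommRing S] [Algebra ℂ S] [Algebra B S] [IsScalarTower ℂ B S]
    (P : SubmersivePresentation B S ι σ) [Fintype {i // i ∉ Set.range P.map}] {b : κ → B}
    (hb : Function.Surjective (aeval b : MvPolynomial κ ℂ →ₐ[ℂ] B)) (θ₀ : S →ₐ[ℂ] ℂ) :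
    let c : ι ⊕ κ → S := Sum.elim P.val fun k => algebraMap B S (b k)
    let E := {i // i ∉ Set.range P.map}
    ∃ Ψ : (κ → ℂ) × (E → ℂ) → (ι ⊕ κ → ℂ),
      AnalyticAt ℂ Ψ (fun k => θ₀ (algebraMap B S (b k)), fun i => θ₀ (P.val i)) ∧
      (∀ᶠ x : (κ → ℂ) × (E → ℂ) in
          𝓝 (fun k => θ₀ (algebraMap B S (b k)), fun i => θ₀ (P.val i)),
        ∀ β : B →ₐ[ℂ] ℂ, (∀ k, β (b k) = x.1 k) → ∃ θ : S →ₐ[ℂ] ℂ,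
          (∀ a, θ (algebraMap B S a) = β a) ∧ (∀ j, θ (c j) = Ψ x j) ∧
            ∀ i : E, θ (P.val i) = x.2 i) ∧
      ∀ᶠ v : ι ⊕ κ → ℂ in 𝓝 (fun j => θ₀ (c j)),
        ∀ θ : S →ₐ[ℂ] ℂ, (∀ j, θ (c j) = v j) →
          Ψ (fun k => v (Sum.inr k), fun i => v (Sum.inl i)) = v := by
  classical
  intro c E
  have := Fintype.ofFinite σ
  choose F hF using fun j => substCoeff_surjective (ι := ι) hb (P.relation j)
  set v₀ : ι ⊕ κ → ℂ := fun j => θ₀ (c j) with hv₀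
  have hθF : ∀ (θ : S →ₐ[ℂ] ℂ) (Q : MvPolynomial (ι ⊕ κ) ℂ),
      θ (aeval P.val (substCoeff b Q)) = aeval (fun j => θ (c j)) Q := fun θ Q =>
    algHom_aeval_substCoeff b P.val θ Q
  have hrel : ∀ (θ : S →ₐ[ℂ] ℂ) j, aeval (fun j => θ (c j)) (F j) = 0 := fun θ j => by
    rw [← hθF, hF, P.aeval_val_relation, map_zero]
  -- Keep the free variables and the base coordinates, and replace the variable attached to a
  -- relation by the value of that relation.
  let G : (ι ⊕ κ → ℂ) → (ι ⊕ κ → ℂ) := fun v => Sum.elim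
    (fun i => if h : ∃ j, P.map j = i then aeval v (F h.choose) else v (Sum.inl i))
    (fun k => v (Sum.inr k))
  have hGmap : ∀ v j, G v (Sum.inl (P.map j)) = aeval v (F j) := fun v j => by
    have h : ∃ j', P.map j' = P.map j := ⟨j, rfl⟩
    simp only [G, Sum.elim_inl, dif_pos h, P.map_inj h.choose_spec]
  have hGfree : ∀ v (i : E), G v (Sum.inl i) = v (Sum.inl i) := fun v i => by
    have h : ¬ ∃ j, P.map j = i.1 := i.2
    simp only [G, Sum.elim_inl, dif_neg h]
  let G' : (ι ⊕ κ → ℂ) →L[ℂ] (ι ⊕ κ → ℂ) := ContinuousLinearMap.pi (Sum.elim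
    (fun i => if h : ∃ j, P.map j = i then
      ∑ k, aeval v₀ (pderiv k (F h.choose)) • (ContinuousLinearMap.proj k : (ι ⊕ κ → ℂ) →L[ℂ] ℂ)
      else ContinuousLinearMap.proj (Sum.inl i))
    (fun k => ContinuousLinearMap.proj (Sum.inr k)))
  have hG' : HasFDerivAt G G' v₀ := by
    rw [hasFDerivAt_pi']
    rintro (i | k)
    · by_cases h : ∃ j, P.map j = i
      · simp only [G, G', Sum.elim_inl, dif_pos h]
        refine (hasFDerivAt_aeval (F h.choose) v₀).congr_fderiv ?_
        ext u
        simp [h]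
      · simp only [G, G', Sum.elim_inl, dif_neg h]
        refine (hasFDerivAt_apply (Sum.inl i) v₀).congr_fderiv ?_
        ext u
        simp [h]
    · simp only [G, G', Sum.elim_inr]
      exact hasFDerivAt_apply (Sum.inr k) v₀
  have hGan : AnalyticAt ℂ G v₀ := by
    refine AnalyticAt.pi ?_
    have hproj : ∀ k, AnalyticAt ℂ (fun v : ι ⊕ κ → ℂ => v k) v₀ := fun k =>
      (ContinuousLinearMap.proj k : (ι ⊕ κ → ℂ) →L[ℂ] ℂ).analyticAt v₀
    rintro (i | k)
    · by_cases h : ∃ j, P.map j = i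
      · simp only [Sum.elim_inl, dif_pos h]
        exact AnalyticAt.aeval_mvPolynomial hproj _
      · simp only [Sum.elim_inl, dif_neg h]
        exact hproj _
    · simp only [Sum.elim_inr]
      exact hproj _
  have hinj : Function.Injective G' := by
    rw [injective_iff_map_eq_zero]
    intro u hu
    have hu' : ∀ k, G' u k = 0 := fun k => congrFun hu k
    have hr : ∀ k, u (Sum.inr k) = 0 := fun k => by simpa [G'] using hu' (Sum.inr k)
    have hl : ∀ i, (¬ ∃ j, P.map j = i) → u (Sum.inl i) = 0 := fun i hi => by
      simpa [G', hi] using hu' (Sum.inl i)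
    have hm : ∀ j, ∑ j', aeval v₀ (pderiv (Sum.inl (P.map j')) (F j)) * u (Sum.inl (P.map j'))
        = 0 := fun j => by
      have h : ∃ j', P.map j' = P.map j := ⟨j, rfl⟩
      have h1 : G' u (Sum.inl (P.map j)) = ∑ k, aeval v₀ (pderiv k (F j)) * u k := by
        simp only [G', ContinuousLinearMap.pi_apply, Sum.elim_inl]
        rw [dif_pos h, P.map_inj h.choose_spec]
        simp
      rw [← hu' (Sum.inl (P.map j)), h1, Fintype.sum_sum_type]
      simp only [hr, mul_zero, Finset.sum_const_zero, add_zero]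
      refine Fintype.sum_of_injective P.map P.map_inj _ _ (fun i hi => ?_) fun _ => rfl
      rw [hl i hi, mul_zero]
    let M : Matrix σ σ ℂ := (P.jacobiMatrix.map fun x => θ₀ (aeval P.val x)).transpose
    have hM : M.det ≠ 0 := by
      have h1 : θ₀ P.jacobian ≠ 0 := (P.jacobian_isUnit.map θ₀).ne_zero
      rw [P.jacobian_eq_jacobiMatrix_det, P.algebraMap_apply] at h1
      have h2 : M.det = θ₀ (aeval P.val P.jacobiMatrix.det) := by
        rw [Matrix.det_transpose]
        exact (RingHom.map_det ((θ₀ : S →+* ℂ).comp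
          (aeval P.val : MvPolynomial ι B →ₐ[B] S).toRingHom) P.jacobiMatrix).symm
      rwa [h2]
    have hMu : M.mulVec (fun j => u (Sum.inl (P.map j))) = 0 := by
      funext j
      rw [Pi.zero_apply, ← hm j]
      refine Finset.sum_congr rfl fun j' _ => ?_
      simp only [M, Matrix.transpose_apply, Matrix.map_apply, P.jacobiMatrix_apply, ← hF,
        pderiv_substCoeff, hθF, hv₀]
    have hu0 := Matrix.eq_zero_of_mulVec_eq_zero hM hMu
    funext k
    rcases k with i | k
    · by_cases h : ∃ j, P.map j = i
      · obtain ⟨j, rfl⟩ := h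
        exact congrFun hu0 j
      · exact hl i h
    · exact hr k
  let e : (ι ⊕ κ → ℂ) ≃L[ℂ] (ι ⊕ κ → ℂ) :=
    (LinearEquiv.ofInjectiveEndo (G' : (ι ⊕ κ → ℂ) →ₗ[ℂ] (ι ⊕ κ → ℂ)) hinj).toContinuousLinearEquiv
  have he : HasFDerivAt G (e : (ι ⊕ κ → ℂ) →L[ℂ] (ι ⊕ κ → ℂ)) v₀ := by
    refine hG'.congr_fderiv ?_
    ext u : 1
    rfl
  have hcd : ContDiffAt ℂ ⊤ G v₀ := hGan.contDiffAt
  have hstrict : HasStrictFDerivAt G (e : (ι ⊕ κ → ℂ) →L[ℂ] (ι ⊕ κ → ℂ)) v₀ :=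
    hcd.hasStrictFDerivAt' he (by simp)
  let Ginv := hstrict.localInverse G e v₀
  have hGinv : AnalyticAt ℂ Ginv (G v₀) := by
    have := hcd.to_localInverse he (by simp)
    exact this.analyticAt
  have hleft : ∀ᶠ v in 𝓝 v₀, Ginv (G v) = v := hstrict.eventually_left_inverse
  have hright : ∀ᶠ w in 𝓝 (G v₀), G (Ginv w) = w := hstrict.eventually_right_inverse
  let ε : (κ → ℂ) × (E → ℂ) → (ι ⊕ κ → ℂ) := fun x => Sum.elim
    (fun i => if h : ∃ j, P.map j = i then 0 else x.2 ⟨i, h⟩) x.1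
  have hεmap : ∀ x j, ε x (Sum.inl (P.map j)) = 0 := fun x j => by
    have h : ∃ j', P.map j' = P.map j := ⟨j, rfl⟩
    simp only [ε, Sum.elim_inl, dif_pos h]
  have hεfree : ∀ x (i : E), ε x (Sum.inl i) = x.2 i := fun x i => by
    have h : ¬ ∃ j, P.map j = i.1 := i.2
    simp only [ε, Sum.elim_inl, dif_neg h]
    rfl
  have hεan : ∀ x, AnalyticAt ℂ ε x := fun x => by
    refine AnalyticAt.pi ?_
    rintro (i | k)
    · by_cases h : ∃ j, P.map j = i
      · simp only [Sum.elim_inl, dif_pos h]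
        exact analyticAt_const
      · simp only [Sum.elim_inl, dif_neg h]
        exact ((ContinuousLinearMap.proj (⟨i, h⟩ : E) : (E → ℂ) →L[ℂ] ℂ).comp
          (ContinuousLinearMap.snd ℂ (κ → ℂ) (E → ℂ))).analyticAt x
    · simp only [Sum.elim_inr]
      exact ((ContinuousLinearMap.proj k : (κ → ℂ) →L[ℂ] ℂ).comp
          (ContinuousLinearMap.fst ℂ (κ → ℂ) (E → ℂ))).analyticAt x
  have hGε : ∀ θ : S →ₐ[ℂ] ℂ, G (fun j => θ (c j)) =
      ε (fun k => θ (c (Sum.inr k)), fun i => θ (c (Sum.inl i))) := fun θ => by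
    funext k
    rcases k with i | k
    · by_cases h : ∃ j, P.map j = i
      · obtain ⟨j, rfl⟩ := h
        rw [hGmap, hεmap, hrel]
      · rw [hGfree _ ⟨i, h⟩, hεfree _ ⟨i, h⟩]
    · rfl
  have hε₀ : ε (fun k => θ₀ (algebraMap B S (b k)), fun i => θ₀ (P.val i)) = G v₀ := (hGε θ₀).symm
  refine ⟨fun x => Ginv (ε x), ?_, ?_, ?_⟩
  · exact AnalyticAt.comp (by rwa [hε₀]) (hεan _)
  · have h1 := (hεan (fun k => θ₀ (algebraMap B S (b k)), fun i => θ₀ (P.val i))).continuousAt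
    rw [ContinuousAt, hε₀] at h1
    filter_upwards [h1.eventually hright] with x hx β hβ
    have hxr : ∀ k, Ginv (ε x) (Sum.inr k) = x.1 k := fun k => congrFun hx (Sum.inr k)
    obtain ⟨θ, hθB, hθv⟩ := exists_algHom_of_relation P.toPresentation β
      (Ginv (ε x) ∘ Sum.inl) (fun j => by
        rw [← hF, eval₂Hom_substCoeff b β _ (fun k => by rw [hβ, hxr]), ← hGmap, hx, hεmap])
    refine ⟨θ, hθB, ?_, fun i => ?_⟩
    · rintro (i | k)
      · exact hθv i
      · change θ (algebraMap B S (b k)) = _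
        rw [hθB, hβ, hxr]
    · have h2 := hGfree (Ginv (ε x)) i
      rw [hx, hεfree] at h2
      rw [hθv, h2, Function.comp_apply]
  · filter_upwards [hleft] with v hv θ hθ
    obtain rfl : v = fun j => θ (c j) := funext fun j => (hθ j).symm
    change Ginv (ε (fun k => θ (c (Sum.inr k)), fun i => θ (c (Sum.inl i)))) = _
    rw [← hGε, hv]

/-! ### The local product structure of a dominant polynomial map -/

theorem exists_algHom_of_mem_zeroLocus {τ : Type*} {A : Type*} [CommRing A] [Algebra ℂ A]
    {a : τ → A} (ha : Function.Surjective (aeval a : MvPolynomial τ ℂ →ₐ[ℂ] A)) {z : τ → ℂ}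
    (hz : z ∈ zeroLocus ℂ (RingHom.ker (aeval a : MvPolynomial τ ℂ →ₐ[ℂ] A))) :
    ∃ α : A →ₐ[ℂ] ℂ, ∀ j, α (a j) = z j :=
  ⟨AlgHom.liftOfSurjective _ ha (aeval z) hz, fun j => by
    have := AlgHom.liftOfSurjective_apply _ ha (aeval z) hz (X j)
    simpa using this⟩

theorem algHom_aeval_eq {τ : Type*} {A : Type*} [CommRing A] [Algebra ℂ A] (a : τ → A)
    (α : A →ₐ[ℂ] ℂ) (p : MvPolynomial τ ℂ) : α (aeval a p) = aeval (fun j => α (a j)) p :=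
  (MvPolynomial.comp_aeval_apply a α p)

/-- The conclusion of `exists_local_product_structure` at a point of a basic open set `g ≠ 0` over
which the map `μ` has a submersive presentation. Here `A` and `B` are the coordinate rings of source
and closure of the image, with coordinates `a` and `b`. -/
theorem exists_local_product_structure_of_presentation {τ κ : Type} [Fintype τ] [Fintype κ]
    {A B S : Type*} [CommRing A] [CommRing B] [CommRing S] [Algebra ℂ A] [Algebra ℂ B] [Algebra ℂ S]
    [Algebra B A] [Algebra B S] [Algebra A S] [IsScalarTower ℂ B A] [IsScalarTower ℂ B S]
    [IsScalarTower ℂ A S] [IsScalarTower B A S] {a : τ → A} {b : κ → B}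
    (ha : Function.Surjective (aeval a : MvPolynomial τ ℂ →ₐ[ℂ] A))
    (hb : Function.Surjective (aeval b : MvPolynomial κ ℂ →ₐ[ℂ] B))
    {μ : κ → MvPolynomial τ ℂ} (hμ : ∀ k, algebraMap B A (b k) = aeval a (μ k))
    {g : MvPolynomial τ ℂ} [IsLocalization.Away (aeval a g) S]
    {ι σ : Type} [Finite ι] [Finite σ] (P : SubmersivePresentation B S ι σ)
    {z : τ → ℂ} (hz : z ∈ zeroLocus ℂ (RingHom.ker (aeval a : MvPolynomial τ ℂ →ₐ[ℂ] A)))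
    (hgz : aeval z g ≠ 0) :
    ∃ (E : Type) (_ : Fintype E) (s : (κ → ℂ) × (E → ℂ) → (τ → ℂ)) (ρ : (τ → ℂ) → (E → ℂ)),
      AnalyticAt ℂ s (fun k => aeval z (μ k), ρ z) ∧ AnalyticAt ℂ ρ z ∧
      (∀ᶠ x in 𝓝 (fun k => aeval z (μ k), ρ z),
        x.1 ∈ zeroLocus ℂ (RingHom.ker (aeval b : MvPolynomial κ ℂ →ₐ[ℂ] B)) →
        s x ∈ zeroLocus ℂ (RingHom.ker (aeval a : MvPolynomial τ ℂ →ₐ[ℂ] A)) ∧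
          (∀ k, aeval (s x) (μ k) = x.1 k) ∧ ρ (s x) = x.2) ∧
      ∀ᶠ z' in 𝓝 z, z' ∈ zeroLocus ℂ (RingHom.ker (aeval a : MvPolynomial τ ℂ →ₐ[ℂ] A)) →
        s (fun k => aeval z' (μ k), ρ z') = z' := by
  classical
  have := Fintype.ofFinite ι
  let c : ι ⊕ κ → S := Sum.elim P.val fun k => algebraMap B S (b k)
  -- the point of `Spec A` over which a complex point of `Spec S` lies
  let pt : (S →ₐ[ℂ] ℂ) → (τ → ℂ) := fun θ j => θ (algebraMap A S (a j))
  have hpt : ∀ θ p, θ (algebraMap A S (aeval a p)) = aeval (pt θ) p := fun θ p =>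
    algHom_aeval_eq a (θ.comp (IsScalarTower.toAlgHom ℂ A S)) p
  have hptI : ∀ θ, pt θ ∈ zeroLocus ℂ (RingHom.ker (aeval a : MvPolynomial τ ℂ →ₐ[ℂ] A)) :=
    fun θ p hp => by
      rw [← hpt, (RingHom.mem_ker.1 hp : aeval a p = 0), map_zero, map_zero]
  have hptμ : ∀ θ k, θ (algebraMap B S (b k)) = aeval (pt θ) (μ k) := fun θ k => by
    rw [IsScalarTower.algebraMap_apply B A S, hμ, hpt]
  have hev : ∀ z' ∈ zeroLocus ℂ (RingHom.ker (aeval a : MvPolynomial τ ℂ →ₐ[ℂ] A)),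
      aeval z' g ≠ 0 → ∃ θ, pt θ = z' := by
    intro z' hz' hgz'
    obtain ⟨α, hα⟩ := exists_algHom_of_mem_zeroLocus ha hz'
    have hu : ∀ y : Submonoid.powers (aeval a g), IsUnit (α y) := by
      rintro ⟨_, n, rfl⟩
      change IsUnit (α (aeval a g ^ n))
      rw [map_pow, algHom_aeval_eq, funext hα]
      exact (isUnit_iff_ne_zero.2 hgz').pow n
    refine ⟨IsLocalization.liftAlgHom (M := Submonoid.powers (aeval a g)) hu, funext fun j => ?_⟩
    change IsLocalization.liftAlgHom (M := Submonoid.powers (aeval a g)) hu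
      (algebraMap A S (a j)) = _
    rw [IsLocalization.liftAlgHom_apply, IsLocalization.lift_eq]
    exact hα j
  -- elements of `S` are rational functions, with powers of `g` as denominators
  have hfrac : ∀ y : S, ∃ (n : ℕ) (p : MvPolynomial τ ℂ),
      y * algebraMap A S (aeval a g) ^ n = algebraMap A S (aeval a p) := fun y => by
    obtain ⟨n, q, hq⟩ := IsLocalization.Away.surj (aeval a g) y
    obtain ⟨p, rfl⟩ := ha q
    exact ⟨n, p, hq⟩
  choose n num hnum using hfrac
  let R : S → (τ → ℂ) → ℂ := fun y v => aeval v (num y) / aeval v g ^ n y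
  have hg : ∀ θ, aeval (pt θ) g ≠ 0 := fun θ => by
    rw [← hpt]
    exact ((IsLocalization.Away.algebraMap_isUnit (aeval a g)).map θ).ne_zero
  have hR : ∀ θ y, R y (pt θ) = θ y := fun θ y => by
    have h1 := congrArg θ (hnum y)
    rw [map_mul, map_pow, hpt, hpt] at h1
    simp only [R]
    rw [← h1, mul_div_cancel_right₀ _ (pow_ne_zero _ (hg θ))]
  have hproj : ∀ v j, AnalyticAt ℂ (fun v : τ → ℂ => v j) v := fun v j =>
    (ContinuousLinearMap.proj j : (τ → ℂ) →L[ℂ] ℂ).analyticAt v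
  have hpoly : ∀ v (p : MvPolynomial τ ℂ), AnalyticAt ℂ (fun v : τ → ℂ => aeval v p) v := fun v p =>
    AnalyticAt.aeval_mvPolynomial (hproj v) p
  have hRan : ∀ y, AnalyticAt ℂ (R y) z := fun y =>
    (hpoly z _).div ((hpoly z g).pow _) (pow_ne_zero _ hgz)
  obtain ⟨θ₀, rfl⟩ := hev z hz hgz
  obtain ⟨Ψ, hΨ, hlift, huniq⟩ := exists_analytic_local_lift P hb θ₀
  choose Y hY using fun j => substCoeff_surjective (ι := ι) hb (P.σ (algebraMap A S (a j)))
  have hYθ : ∀ θ : S →ₐ[ℂ] ℂ, ∀ j, aeval (fun k => θ (c k)) (Y j) = pt θ j := fun θ j => by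
    rw [← algHom_aeval_substCoeff b P.val θ, hY, P.aeval_val_σ]
  have hbase : ((fun k => aeval (pt θ₀) (μ k),
      fun i : {i // i ∉ Set.range P.map} => R (P.val i) (pt θ₀)) :
      (κ → ℂ) × ({i // i ∉ Set.range P.map} → ℂ)) =
      (fun k => θ₀ (algebraMap B S (b k)),
        fun i : {i // i ∉ Set.range P.map} => θ₀ (P.val i)) := by
    simp only [hptμ, hR]
  refine ⟨{i // i ∉ Set.range P.map}, inferInstance, fun x j => aeval (Ψ x) (Y j),
    fun v i => R (P.val i) v, ?_, ?_, ?_, ?_⟩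
  · rw [hbase]
    refine AnalyticAt.pi fun j => AnalyticAt.aeval_mvPolynomial (fun k => ?_) _
    exact ((ContinuousLinearMap.proj k : (ι ⊕ κ → ℂ) →L[ℂ] ℂ).analyticAt _).comp hΨ
  · exact AnalyticAt.pi fun i => hRan _
  · rw [hbase]
    filter_upwards [hlift] with x hx hxQ
    obtain ⟨β, hβ⟩ := exists_algHom_of_mem_zeroLocus hb hxQ
    obtain ⟨θ, hθB, hθΨ, hθE⟩ := hx β hβ
    have hs : (fun j => aeval (Ψ x) (Y j)) = pt θ := by
      funext j
      rw [← hYθ, funext hθΨ]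
    simp only [hs]
    refine ⟨hptI θ, fun k => ?_, funext fun i => ?_⟩
    · rw [← hptμ, hθB, hβ]
    · rw [hR, hθE]
  · have hcont : ContinuousAt (fun v : τ → ℂ => fun k : ι ⊕ κ => R (c k) v) (pt θ₀) :=
      continuousAt_pi.2 fun k => (hRan _).continuousAt
    have h0 : (fun k => R (c k) (pt θ₀)) = fun k => θ₀ (c k) := funext fun k => hR _ _
    rw [ContinuousAt, h0] at hcont
    filter_upwards [hcont.eventually huniq, (hpoly _ g).continuousAt.eventually_ne hgz]
      with v hv hgv hvI
    obtain ⟨θ, rfl⟩ := hev v hvI hgv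
    have h1 := hv θ fun k => (hR _ _).symm
    have h2 : Ψ (fun k => aeval (pt θ) (μ k), fun i => R (P.val i) (pt θ)) =
        fun k => θ (c k) := by
      have h3 : (fun k => R (c k) (pt θ)) = fun k => θ (c k) := funext fun k => hR _ _
      rw [← h3, ← h1]
      congr 2
      funext k
      simp only [c, Sum.elim_inr]
      rw [← hptμ, hR]
    funext j
    rw [h2, hYθ]

theorem aeval_mk_X {τ : Type*} (I : Ideal (MvPolynomial τ ℂ)) :
    (aeval (fun j => Ideal.Quotient.mk I (X j)) : MvPolynomial τ ℂ →ₐ[ℂ] MvPolynomial τ ℂ ⧸ I) =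
      Ideal.Quotient.mkₐ ℂ I := by
  ext j
  rw [aeval_X]
  rfl

/-- Over the closure of its image, a polynomial map `μ` on an irreducible affine variety is locally,
near a general point `z`, the first projection of an analytic product: `z' ↦ (μ z', ρ z')` has the
analytic local inverse `s`. The zero locus of `I.comap (aeval μ)` is the closure of the image. -/
theorem exists_local_product_structure {τ κ : Type} [Fintype τ] [Fintype κ]
    (I : Ideal (MvPolynomial τ ℂ)) [I.IsPrime] (μ : κ → MvPolynomial τ ℂ) :
    ∃ g ∉ I, ∀ z ∈ zeroLocus ℂ I, aeval z g ≠ 0 →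
      ∃ (E : Type) (_ : Fintype E) (s : (κ → ℂ) × (E → ℂ) → (τ → ℂ)) (ρ : (τ → ℂ) → (E → ℂ)),
        AnalyticAt ℂ s (fun k => aeval z (μ k), ρ z) ∧ AnalyticAt ℂ ρ z ∧
        (∀ᶠ x in 𝓝 (fun k => aeval z (μ k), ρ z), x.1 ∈ zeroLocus ℂ
            (I.comap (aeval μ : MvPolynomial κ ℂ →ₐ[ℂ] MvPolynomial τ ℂ)) →
          s x ∈ zeroLocus ℂ I ∧ (∀ k, aeval (s x) (μ k) = x.1 k) ∧ ρ (s x) = x.2) ∧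
        ∀ᶠ z' in 𝓝 z, z' ∈ zeroLocus ℂ I → s (fun k => aeval z' (μ k), ρ z') = z' := by
  generalize hQ : I.comap (aeval μ : MvPolynomial κ ℂ →ₐ[ℂ] MvPolynomial τ ℂ) = Q
  have hQ' : Q.IsPrime := hQ ▸ Ideal.comap_isPrime _ _
  let i : (MvPolynomial κ ℂ ⧸ Q) →ₐ[ℂ] (MvPolynomial τ ℂ ⧸ I) :=
    Ideal.quotientMapₐ I (aeval μ) hQ.ge
  have hi : Function.Injective i := Ideal.quotientMap_injective' (H := hQ.ge) hQ.le
  let : Algebra (MvPolynomial κ ℂ ⧸ Q) (MvPolynomial τ ℂ ⧸ I) := i.toRingHom.toAlgebra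
  have : IsScalarTower ℂ (MvPolynomial κ ℂ ⧸ Q) (MvPolynomial τ ℂ ⧸ I) :=
    IsScalarTower.of_algebraMap_eq fun a => (i.commutes a).symm
  have : FaithfulSMul (MvPolynomial κ ℂ ⧸ Q) (MvPolynomial τ ℂ ⧸ I) :=
    (faithfulSMul_iff_algebraMap_injective _ _).2 hi
  have : CharZero (MvPolynomial κ ℂ ⧸ Q) :=
    charZero_of_injective_algebraMap (algebraMap ℂ (MvPolynomial κ ℂ ⧸ Q)).injective
  have : Algebra.FiniteType (MvPolynomial κ ℂ ⧸ Q) (MvPolynomial τ ℂ ⧸ I) :=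
    .of_restrictScalars_finiteType ℂ _ _
  obtain ⟨f, hf0, hsm⟩ := exists_isStandardSmooth_away (MvPolynomial κ ℂ ⧸ Q) (MvPolynomial τ ℂ ⧸ I)
  obtain ⟨g, rfl⟩ := Ideal.Quotient.mk_surjective f
  obtain ⟨ι, σ, _, _, ⟨P⟩⟩ := hsm.out
  refine ⟨g, fun h => hf0 (Ideal.Quotient.eq_zero_iff_mem.2 h), fun z hz hgz => ?_⟩
  have hkI : RingHom.ker (aeval (fun j => Ideal.Quotient.mk I (X j)) :
      MvPolynomial τ ℂ →ₐ[ℂ] MvPolynomial τ ℂ ⧸ I) = I := by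
    rw [aeval_mk_X]; exact Ideal.Quotient.mkₐ_ker ℂ I
  have hkQ : RingHom.ker (aeval (fun j => Ideal.Quotient.mk Q (X j)) :
      MvPolynomial κ ℂ →ₐ[ℂ] MvPolynomial κ ℂ ⧸ Q) = Q := by
    rw [aeval_mk_X]; exact Ideal.Quotient.mkₐ_ker ℂ Q
  have hg : aeval (fun j => Ideal.Quotient.mk I (X j)) g = Ideal.Quotient.mk I g := by
    rw [aeval_mk_X]; rfl
  have hloc : IsLocalization.Away (aeval (fun j => Ideal.Quotient.mk I (X j)) g)
      (Localization.Away (Ideal.Quotient.mk I g)) := by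
    rw [hg]; infer_instance
  have haI : Function.Surjective (aeval (fun j => Ideal.Quotient.mk I (X j)) :
      MvPolynomial τ ℂ →ₐ[ℂ] MvPolynomial τ ℂ ⧸ I) := by
    rw [aeval_mk_X]; exact Ideal.Quotient.mkₐ_surjective ℂ I
  have haQ : Function.Surjective (aeval (fun j => Ideal.Quotient.mk Q (X j)) :
      MvPolynomial κ ℂ →ₐ[ℂ] MvPolynomial κ ℂ ⧸ Q) := by
    rw [aeval_mk_X]; exact Ideal.Quotient.mkₐ_surjective ℂ Q
  have hbμ : ∀ k, algebraMap (MvPolynomial κ ℂ ⧸ Q) (MvPolynomial τ ℂ ⧸ I)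
      (Ideal.Quotient.mk Q (X k)) = aeval (fun j => Ideal.Quotient.mk I (X j)) (μ k) := fun k => by
    rw [aeval_mk_X]
    change Ideal.Quotient.mk I (aeval μ (X k)) = _
    rw [aeval_X]
    rfl
  have hmain := exists_local_product_structure_of_presentation (A := MvPolynomial τ ℂ ⧸ I)
    (B := MvPolynomial κ ℂ ⧸ Q) (S := Localization.Away (Ideal.Quotient.mk I g))
    (a := fun j => Ideal.Quotient.mk I (X j)) (b := fun k => Ideal.Quotient.mk Q (X k))
    haI haQ hbμ P (z := z) (by rwa [hkI]) hgz
  rw [hkI, hkQ] at hmain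
  exact hmain

/-! ### Homogeneity and products of irreducible sets -/

/-- A weighted homogeneous polynomial transforms under the torus by the character of its weight. -/
theorem aeval_mul_of_isWeightedHomogeneous {τ M : Type*} [AddCommMonoid M] {w : τ → M} {d : M}
    {f : MvPolynomial τ ℂ} (hf : f.IsWeightedHomogeneous w d) (χ : Multiplicative M →* ℂ)
    (v : τ → ℂ) :
    aeval (fun k => χ (.ofAdd (w k)) * v k) f = χ (.ofAdd d) * aeval v f := by
  simp only [aeval_eq_eval, eval_eq, Finset.mul_sum]
  refine Finset.sum_congr rfl fun m hm => ?_
  have h1 : ∏ i ∈ m.support, χ (.ofAdd (w i)) ^ m i = χ (.ofAdd d) := by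
    rw [← hf (mem_support_iff.1 hm), Finsupp.weight_apply, Finsupp.sum, ofAdd_sum, map_prod]
    simp [ofAdd_nsmul]
  simp only [mul_pow, Finset.prod_mul_distrib, h1]
  ring

theorem aeval_smul_of_isHomogeneous {τ : Type*} {d : ℕ} {f : MvPolynomial τ ℂ}
    (hf : f.IsHomogeneous d) (t : ℂ) (v : τ → ℂ) : aeval (t • v) f = t ^ d * aeval v f := by
  have := aeval_mul_of_isWeightedHomogeneous hf (powersHom ℂ t) v
  simp only [Pi.one_apply, powersHom_apply, toAdd_ofAdd, pow_one] at this
  exact this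

theorem aeval_smul {τ : Type*} (f : MvPolynomial τ ℂ) (t : ℂ) (v : τ → ℂ) :
    aeval (t • v) f = ∑ d ∈ Finset.range (f.totalDegree + 1),
      t ^ d * aeval v (homogeneousComponent d f) := by
  conv_lhs => rw [← sum_homogeneousComponent f]
  rw [map_sum]
  exact Finset.sum_congr rfl fun d _ =>
    aeval_smul_of_isHomogeneous (homogeneousComponent_isHomogeneous d f) t v

theorem aeval_homogeneousComponent_eq_zero {τ : Type*} {f : MvPolynomial τ ℂ} {v : τ → ℂ}
    (h : ∀ t : ℂ, aeval (t • v) f = 0) (d : ℕ) : aeval v (homogeneousComponent d f) = 0 := by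
  by_cases hd : d ∈ Finset.range (f.totalDegree + 1)
  · have h1 : (∑ d ∈ Finset.range (f.totalDegree + 1),
        Polynomial.monomial d (aeval v (homogeneousComponent d f))) = 0 := by
      refine Polynomial.funext fun t => ?_
      rw [Polynomial.eval_finsetSum, Polynomial.eval_zero, ← h t, aeval_smul]
      simp [mul_comm]
    have h2 := congrArg (fun p => Polynomial.coeff p d) h1
    simpa [Polynomial.finsetSum_coeff, Polynomial.coeff_monomial,
      Nat.lt_succ_iff.1 (Finset.mem_range.1 hd)] using h2
  · rw [homogeneousComponent_eq_zero _ _ (by simpa using hd), map_zero]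

/-- The character `d ↦ ∏ i, a i ^ d i` of the monoid of multidegrees. -/
noncomputable def multiPow {ι : Type*} [Fintype ι] (a : ι → ℂ) : Multiplicative (ι → ℕ) →* ℂ where
  toFun d := ∏ i, a i ^ d.toAdd i
  map_one' := by simp
  map_mul' d e := by simp [pow_add, Finset.prod_mul_distrib]

theorem multiPow_single {ι : Type*} [Fintype ι] [DecidableEq ι] (a : ι → ℂ) (i : ι) :
    multiPow a (.ofAdd (Pi.single i 1)) = a i := by
  change ∏ j, a j ^ (Pi.single i 1 : ι → ℕ) j = a i
  rw [Finset.prod_eq_single i] <;> simp +contextual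

/-- Rescaling the blocks of variables separates the multihomogeneous components. -/
theorem aeval_mul_eq_sum {ι κ : Type*} [Fintype ι] [DecidableEq ι] (f : MvPolynomial (ι × κ) ℂ)
    (a : ι → ℂ) (v : ι × κ → ℂ) :
    aeval (fun k => a k.1 * v k) f =
      ∑ d ∈ (weightedHomogeneousComponent_finsupp
        (w := fun k : ι × κ => (Pi.single k.1 1 : ι → ℕ)) f).toFinset, (∏ i, a i ^ d i) *
          aeval v (weightedHomogeneousComponent (fun k : ι × κ => (Pi.single k.1 1 : ι → ℕ)) d f) := by
  conv_lhs => rw [← sum_weightedHomogeneousComponent (fun k : ι × κ => (Pi.single k.1 1 : ι → ℕ)) f,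
    finsum_eq_sum _ (weightedHomogeneousComponent_finsupp f)]
  rw [map_sum]
  refine Finset.sum_congr rfl fun d _ => ?_
  have h := aeval_mul_of_isWeightedHomogeneous (weightedHomogeneousComponent_isWeightedHomogeneous
    (w := fun k : ι × κ => (Pi.single k.1 1 : ι → ℕ)) d f) (multiPow a) v
  simp only [multiPow_single] at h
  exact h

theorem aeval_multihomogeneousComponent_eq_zero {ι κ : Type*} [Fintype ι] [DecidableEq ι]
    {f : MvPolynomial (ι × κ) ℂ} {v : ι × κ → ℂ}
    (h : ∀ a : ι → ℂ, aeval (fun k => a k.1 * v k) f = 0) (d : ι → ℕ) :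
    aeval v (weightedHomogeneousComponent (fun k : ι × κ => (Pi.single k.1 1 : ι → ℕ)) d f) = 0 := by
  classical
  set w := fun k : ι × κ => (Pi.single k.1 1 : ι → ℕ) with hw
  have hfin := weightedHomogeneousComponent_finsupp (w := w) f
  by_cases hd : weightedHomogeneousComponent w d f = 0
  · rw [hd, map_zero]
  have h1 : (∑ e ∈ hfin.toFinset, monomial (Finsupp.equivFunOnFinite.symm e)
      (aeval v (weightedHomogeneousComponent w e f))) = (0 : MvPolynomial ι ℂ) := by
    refine MvPolynomial.funext fun a => ?_
    rw [map_zero, ← h a, aeval_mul_eq_sum, map_sum]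
    refine Finset.sum_congr rfl fun e _ => ?_
    rw [eval_monomial, mul_comm, Finsupp.prod_fintype _ _ (by simp)]
    rfl
  have h2 := congrArg (coeff (Finsupp.equivFunOnFinite.symm d)) h1
  rw [coeff_sum, coeff_zero, Finset.sum_eq_single d] at h2
  · simpa using h2
  · intro e _ hed
    rw [coeff_monomial, if_neg]
    exact fun h => hed (Finsupp.equivFunOnFinite.symm.injective h)
  · intro h
    exact absurd (hfin.mem_toFinset.2 hd) h

/-- The vanishing ideal of a nonempty set is prime if any two nonempty basic open subsets of the set
intersect. -/
theorem isPrime_vanishingIdeal {τ : Type*} {Z : Set (τ → ℂ)} (hne : Z.Nonempty)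
    (h : ∀ f g : MvPolynomial τ ℂ, (∃ v ∈ Z, aeval v f ≠ 0) → (∃ v ∈ Z, aeval v g ≠ 0) →
      ∃ v ∈ Z, aeval v f ≠ 0 ∧ aeval v g ≠ 0) : (vanishingIdeal ℂ Z).IsPrime := by
  refine ⟨?_, fun {f g} hfg => ?_⟩
  · rw [Ne, Ideal.eq_top_iff_one]
    obtain ⟨v, hv⟩ := hne
    intro h1
    simpa using h1 v hv
  · by_contra hcon
    simp only [mem_vanishingIdeal_iff, not_or, not_forall] at hcon
    obtain ⟨⟨v, hv, hf⟩, ⟨u, hu, hg⟩⟩ := hcon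
    obtain ⟨x, hx, hxf, hxg⟩ := h f g ⟨v, hv, hf⟩ ⟨u, hu, hg⟩
    have := hfg x hx
    rw [map_mul] at this
    exact mul_ne_zero hxf hxg this

theorem exists_aeval_ne_zero {τ : Type*} {Z : Set (τ → ℂ)} (h : (vanishingIdeal ℂ Z).IsPrime)
    {f g : MvPolynomial τ ℂ} (hf : ∃ v ∈ Z, aeval v f ≠ 0) (hg : ∃ v ∈ Z, aeval v g ≠ 0) :
    ∃ v ∈ Z, aeval v f ≠ 0 ∧ aeval v g ≠ 0 := by
  obtain ⟨v, hv, hf⟩ := hf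
  obtain ⟨u, hu, hg⟩ := hg
  have hfg : f * g ∉ vanishingIdeal ℂ Z := fun hfg => by
    rcases h.mem_or_mem hfg with h1 | h1
    · exact hf (h1 v hv)
    · exact hg (h1 u hu)
  simp only [mem_vanishingIdeal_iff, not_forall, map_mul] at hfg
  obtain ⟨x, hx, hne⟩ := hfg
  exact ⟨x, hx, left_ne_zero_of_mul hne, right_ne_zero_of_mul hne⟩

/-- The product of a family of subsets of affine spaces. -/
def blockProd {ι κ : Type*} (Z : ι → Set (κ → ℂ)) : Set (ι × κ → ℂ) :=
  {z | ∀ i, (fun k => z (i, k)) ∈ Z i}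

theorem zeroLocus_vanishingIdeal_blockProd {ι κ : Type*} [DecidableEq ι] {Z : ι → Set (κ → ℂ)}
    (hZ : ∀ i, zeroLocus ℂ (vanishingIdeal ℂ (Z i)) = Z i) :
    zeroLocus ℂ (vanishingIdeal ℂ (blockProd Z)) = blockProd Z := by
  refine le_antisymm (fun z hz i => ?_) (zeroLocus_vanishingIdeal_le _)
  rw [← hZ i]
  intro f hf
  have := hz (rename (fun k => (i, k)) f) fun v hv => by
    rw [aeval_rename]
    exact hf _ (hv i)
  rwa [aeval_rename] at this

/-- The restriction of a polynomial to the block of variables with index `i`, the other blocks being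
fixed. -/
theorem exists_polynomial_slice {ι κ : Type*} [DecidableEq ι] (f : MvPolynomial (ι × κ) ℂ)
    (a : ι × κ → ℂ) (i : ι) : ∃ p : MvPolynomial κ ℂ, ∀ x : κ → ℂ,
      aeval x p = aeval (fun k => if k.1 = i then x k.2 else a k) f := by
  refine ⟨aeval (fun k : ι × κ => if k.1 = i then X k.2 else C (a k)) f, fun x => ?_⟩
  rw [comp_aeval_apply]
  congr 2
  funext k
  split_ifs <;> simp

/-- A product of irreducible sets is irreducible. -/
theorem isPrime_vanishingIdeal_blockProd {ι κ : Type*} [Fintype ι] {Z : ι → Set (κ → ℂ)}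
    (hne : ∀ i, (Z i).Nonempty) (hZ : ∀ i, (vanishingIdeal ℂ (Z i)).IsPrime) :
    (vanishingIdeal ℂ (blockProd Z)).IsPrime := by
  classical
  choose z hz using hne
  refine isPrime_vanishingIdeal ⟨fun k => z k.1 k.2, hz⟩ ?_
  rintro f g ⟨a, ha, hfa⟩ ⟨b, hb, hgb⟩
  -- the two points are made equal one block at a time
  have key : ∀ T : Finset ι, ∃ a ∈ blockProd Z, ∃ b ∈ blockProd Z, aeval a f ≠ 0 ∧
      aeval b g ≠ 0 ∧ ∀ i ∈ T, ∀ k, a (i, k) = b (i, k) := by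
    intro T
    induction T using Finset.induction_on with
    | empty => exact ⟨a, ha, b, hb, hfa, hgb, by simp⟩
    | insert i T _ ih =>
      obtain ⟨a, ha, b, hb, hfa, hgb, hab⟩ := ih
      obtain ⟨p, hp⟩ := exists_polynomial_slice f a i
      obtain ⟨q, hq⟩ := exists_polynomial_slice g b i
      have hself : ∀ c : ι × κ → ℂ, (fun k : ι × κ => if k.1 = i then c (i, k.2) else c k) = c := by
        intro c
        funext k
        split_ifs with h
        · rw [← h]
        · rfl
      obtain ⟨x, hx, hxp, hxq⟩ := exists_aeval_ne_zero (hZ i) (f := p) (g := q)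
        ⟨_, ha i, by rwa [hp, hself]⟩ ⟨_, hb i, by rwa [hq, hself]⟩
      have hmem : ∀ c ∈ blockProd Z, (fun k : ι × κ => if k.1 = i then x k.2 else c k) ∈
          blockProd Z := by
        intro c hc j
        by_cases h : j = i
        · subst h
          simpa using hx
        · simpa [h] using hc j
      refine ⟨_, hmem a ha, _, hmem b hb, by rwa [← hp], by rwa [← hq], fun j hj k => ?_⟩
      by_cases h : j = i
      · simp [h]
      · simpa [h] using hab j ((Finset.mem_insert.1 hj).resolve_left h) k
  obtain ⟨a, ha, b, hb, hfa, hgb, hab⟩ := key Finset.univ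
  obtain rfl : a = b := funext fun k => hab k.1 (Finset.mem_univ _) k.2
  exact ⟨a, ha, hfa, hgb⟩

/-! ### Affine cones and the cone over a join -/

variable {r : ℕ}

/-- The affine cone over a subset of `P^r`, the origin included (unless the subset is empty). -/
def affineCone (X : Set (PSpace r)) : Set (Fin (r + 1) → ℂ) := {v | ∃ x ∈ X, v ∈ x.submodule}

theorem mem_submodule_iff_exists_rep {x : PSpace r} {v : Fin (r + 1) → ℂ} :
    v ∈ x.submodule ↔ ∃ c : ℂ, c • x.rep = v := by
  rw [x.submodule_eq, Submodule.mem_span_singleton]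

theorem rep_mem_submodule (x : PSpace r) : x.rep ∈ x.submodule :=
  mem_submodule_iff_exists_rep.2 ⟨1, one_smul _ _⟩

theorem eq_mk_of_mem_submodule {x : PSpace r} {v : Fin (r + 1) → ℂ} (hv : v ≠ 0)
    (h : v ∈ x.submodule) : Projectivization.mk ℂ v hv = x := by
  obtain ⟨c, rfl⟩ := mem_submodule_iff_exists_rep.1 h
  conv_rhs => rw [← x.mk_rep]
  exact (Projectivization.mk_eq_mk_iff' ..).2 ⟨c, rfl⟩

theorem mem_submodule_mk {v : Fin (r + 1) → ℂ} (hv : v ≠ 0) :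
    v ∈ (Projectivization.mk ℂ v hv).submodule := by
  rw [Projectivization.submodule_mk]
  exact Submodule.mem_span_singleton_self v

theorem mem_coneOf_iff {X : Set (PSpace r)} {v : Fin (r + 1) → ℂ} :
    v ∈ coneOf X ↔ v ≠ 0 ∧ v ∈ affineCone X := by
  constructor
  · rintro ⟨hv, hX⟩
    exact ⟨hv, _, hX, mem_submodule_mk hv⟩
  · rintro ⟨hv, x, hx, h⟩
    exact ⟨hv, by rwa [eq_mk_of_mem_submodule hv h]⟩

theorem smul_mem_affineCone {X : Set (PSpace r)} {v : Fin (r + 1) → ℂ} (hv : v ∈ affineCone X)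
    (c : ℂ) : c • v ∈ affineCone X := by
  obtain ⟨x, hx, h⟩ := hv
  exact ⟨x, hx, Submodule.smul_mem _ c h⟩

theorem affineCone_nonempty {X : Set (PSpace r)} (hX : X.Nonempty) : (affineCone X).Nonempty :=
  let ⟨x, hx⟩ := hX
  ⟨0, x, hx, Submodule.zero_mem _⟩

theorem isOpen_zariski_aeval_rep_ne_zero {d : ℕ} {f : MvPolynomial (Fin (r + 1)) ℂ}
    (hf : f.IsHomogeneous d) : IsOpen[zariski r] {x | aeval x.rep f ≠ 0} :=
  TopologicalSpace.isOpen_generateFrom_of_mem ⟨d, f, hf, rfl⟩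

theorem exists_homogeneous_of_isOpen_zariski {U : Set (PSpace r)} (hU : IsOpen[zariski r] U)
    {x : PSpace r} (hx : x ∈ U) : ∃ (d : ℕ) (f : MvPolynomial (Fin (r + 1)) ℂ),
      f.IsHomogeneous d ∧ aeval x.rep f ≠ 0 ∧ ∀ y, aeval y.rep f ≠ 0 → y ∈ U := by
  change TopologicalSpace.GenerateOpen _ U at hU
  induction hU with
  | basic s hs =>
    obtain ⟨d, f, hf, rfl⟩ := hs
    exact ⟨d, f, hf, hx, fun y hy => hy⟩
  | univ => exact ⟨0, 1, isHomogeneous_one _ _, by simp, fun _ _ => trivial⟩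
  | inter s t _ _ ihs iht =>
    obtain ⟨d, f, hf, hfx, hfs⟩ := ihs hx.1
    obtain ⟨e, g, hg, hgx, hgt⟩ := iht hx.2
    refine ⟨d + e, f * g, hf.mul hg, by rw [map_mul]; exact mul_ne_zero hfx hgx, fun y hy => ?_⟩
    rw [map_mul] at hy
    exact ⟨hfs y (left_ne_zero_of_mul hy), hgt y (right_ne_zero_of_mul hy)⟩
  | sUnion S _ ih =>
    obtain ⟨s, hs, hxs⟩ := hx
    obtain ⟨d, f, hf, hfx, hfs⟩ := ih s hs hxs
    exact ⟨d, f, hf, hfx, fun y hy => ⟨s, hs, hfs y hy⟩⟩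

theorem exists_homogeneous_of_notMem {X : Set (PSpace r)} (hX : IsClosed[zariski r] X)
    {x : PSpace r} (hx : x ∉ X) : ∃ (d : ℕ) (f : MvPolynomial (Fin (r + 1)) ℂ),
      f.IsHomogeneous d ∧ aeval x.rep f ≠ 0 ∧ ∀ y ∈ X, aeval y.rep f = 0 := by
  obtain ⟨d, f, hf, hfx, h⟩ := exists_homogeneous_of_isOpen_zariski hX.isOpen_compl hx
  exact ⟨d, f, hf, hfx, fun y hy => by_contra fun hne => h y hne hy⟩

theorem zeroLocus_vanishingIdeal_affineCone {X : Set (PSpace r)} (hX : IsClosed[zariski r] X)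
    (hne : X.Nonempty) : zeroLocus ℂ (vanishingIdeal ℂ (affineCone X)) = affineCone X := by
  refine le_antisymm (fun v hv => ?_) (zeroLocus_vanishingIdeal_le _)
  by_cases hv0 : v = 0
  · subst hv0
    obtain ⟨x, hx⟩ := hne
    exact ⟨x, hx, Submodule.zero_mem _⟩
  refine (mem_coneOf_iff.1 ⟨hv0, ?_⟩).2
  by_contra hcon
  obtain ⟨d, f, hf, hfx, hfX⟩ := exists_homogeneous_of_notMem hX hcon
  obtain ⟨c, hc⟩ := mem_submodule_iff_exists_rep.1 (mem_submodule_mk hv0)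
  have h1 : aeval v f = 0 := hv f fun u hu => by
    obtain ⟨y, hy, hyu⟩ := hu
    obtain ⟨c', rfl⟩ := mem_submodule_iff_exists_rep.1 hyu
    rw [aeval_smul_of_isHomogeneous hf, hfX y hy, mul_zero]
  rw [← hc, aeval_smul_of_isHomogeneous hf] at h1
  rcases mul_eq_zero.1 h1 with h1 | h1
  · have : c = 0 := by
      by_contra hc0
      exact pow_ne_zero _ hc0 h1
    rw [this, zero_smul] at hc
    exact hv0 hc.symm
  · exact hfx h1

theorem exists_homogeneousComponent_ne_zero {X : Set (PSpace r)}
    {f : MvPolynomial (Fin (r + 1)) ℂ} (hf : ∃ v ∈ affineCone X, aeval v f ≠ 0) :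
    ∃ d, ∃ x ∈ X, aeval x.rep (homogeneousComponent d f) ≠ 0 := by
  obtain ⟨v, ⟨x, hx, hv⟩, hf⟩ := hf
  obtain ⟨c, rfl⟩ := mem_submodule_iff_exists_rep.1 hv
  by_contra! hcon
  refine hf ?_
  rw [aeval_smul]
  exact Finset.sum_eq_zero fun d _ => by rw [hcon d x hx, mul_zero]

/-- The cone over an irreducible set is irreducible: two nonempty basic open subsets of the cone
meet a common line, and there they are cofinite. -/
theorem isPrime_vanishingIdeal_affineCone {X : Set (PSpace r)}
    (hX : @IsIrreducible _ (zariski r) X) : (vanishingIdeal ℂ (affineCone X)).IsPrime := by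
  refine isPrime_vanishingIdeal (affineCone_nonempty hX.1) fun f g hf hg => ?_
  obtain ⟨d, x, hx, hfx⟩ := exists_homogeneousComponent_ne_zero hf
  obtain ⟨e, y, hy, hgy⟩ := exists_homogeneousComponent_ne_zero hg
  obtain ⟨u, hu, hfu, hgu⟩ := hX.2 _ _
    (isOpen_zariski_aeval_rep_ne_zero (homogeneousComponent_isHomogeneous d f))
    (isOpen_zariski_aeval_rep_ne_zero (homogeneousComponent_isHomogeneous e g))
    ⟨x, hx, hfx⟩ ⟨y, hy, hgy⟩
  -- the restrictions of `f` and `g` to the line of `u` are nonzero polynomials in one variable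
  have hline : ∀ p : MvPolynomial (Fin (r + 1)) ℂ, ∃ q : Polynomial ℂ,
      ∀ t, q.eval t = aeval (t • u.rep) p := fun p => by
    refine ⟨aeval (fun j => Polynomial.C (u.rep j) * Polynomial.X) p, fun t => ?_⟩
    rw [← Polynomial.coe_aeval_eq_eval, comp_aeval_apply]
    congr 2
    funext j
    rw [map_mul, Polynomial.aeval_C, Polynomial.aeval_X, mul_comm]
    rfl
  obtain ⟨p, hp⟩ := hline f
  obtain ⟨q, hq⟩ := hline g
  have hp0 : p ≠ 0 := by
    rintro rfl
    exact hfu (aeval_homogeneousComponent_eq_zero (fun t => by rw [← hp, Polynomial.eval_zero]) d)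
  have hq0 : q ≠ 0 := by
    rintro rfl
    exact hgu (aeval_homogeneousComponent_eq_zero (fun t => by rw [← hq, Polynomial.eval_zero]) e)
  obtain ⟨t, ht⟩ : ∃ t, (p * q).eval t ≠ 0 := by
    by_contra! h
    exact mul_ne_zero hp0 hq0 (Polynomial.funext fun t => by rw [h, Polynomial.eval_zero])
  rw [Polynomial.eval_mul, hp, hq] at ht
  exact ⟨t • u.rep, ⟨u, hu, mem_submodule_iff_exists_rep.2 ⟨t, rfl⟩⟩, left_ne_zero_of_mul ht,
    right_ne_zero_of_mul ht⟩

/-- The coordinates of the sum of a family of vectors, as polynomials in the coordinates of the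
family. -/
noncomputable def sumPoly (ι : Type*) [Fintype ι] (r : ℕ) (j : Fin (r + 1)) :
    MvPolynomial (ι × Fin (r + 1)) ℂ := ∑ i, X (i, j)

theorem aeval_sumPoly {ι : Type*} [Fintype ι] (z : ι × Fin (r + 1) → ℂ) (j : Fin (r + 1)) :
    aeval z (sumPoly ι r j) = ∑ i, z (i, j) := by
  simp [sumPoly]

theorem mem_coneOf_join_of_mem_pointSpan {ι : Type} {X : ι → Set (PSpace r)} {p : ι → PSpace r}
    (hp : p ∈ Set.univ.pi X) {v : Fin (r + 1) → ℂ} (hv0 : v ≠ 0) (hv : v ∈ pointSpan p) :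
    v ∈ coneOf (join X) := by
  refine ⟨hv0, @subset_closure _ (zariski r) _ _ (Set.mem_biUnion hp ?_)⟩
  change Projectivization.submodule _ ≤ _
  rw [Projectivization.submodule_mk, Submodule.span_singleton_le_iff_mem]
  exact hv

theorem mem_pointSpan_iff {ι : Type} [Fintype ι] {p : ι → PSpace r} {v : Fin (r + 1) → ℂ} :
    v ∈ pointSpan p ↔ ∃ a : ι → ℂ, ∑ i, a i • (p i).rep = v := by
  simp only [pointSpan, Projectivization.submodule_eq]
  rw [← Submodule.span_range_eq_iSup, Submodule.mem_span_range_iff_exists_fun]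

theorem join_nonempty {ι : Type} [Nonempty ι] {X : ι → Set (PSpace r)} (hX : ∀ i, (X i).Nonempty) :
    (join X).Nonempty := by
  choose x hx using hX
  let i : ι := Classical.arbitrary ι
  exact ⟨_, (mem_coneOf_join_of_mem_pointSpan (fun i _ => hx i) (x i).rep_nonzero
    ((le_iSup (fun i => (x i).submodule) i) (rep_mem_submodule (x i)))).2⟩

theorem sum_mem_affineCone_join {ι : Type} [Fintype ι] [Nonempty ι] {X : ι → Set (PSpace r)}
    {z : ι × Fin (r + 1) → ℂ} (hz : z ∈ blockProd fun i => affineCone (X i)) :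
    (fun j => ∑ i, z (i, j)) ∈ affineCone (join X) := by
  choose x hx hxz using hz
  have hsum : (fun j => ∑ i, z (i, j)) = ∑ i, fun j => z (i, j) := by
    funext j
    rw [Finset.sum_apply]
  by_cases h0 : (fun j => ∑ i, z (i, j)) = 0
  · rw [h0]
    obtain ⟨y, hy⟩ := join_nonempty fun i => ⟨x i, hx i⟩
    exact ⟨y, hy, Submodule.zero_mem _⟩
  · refine (mem_coneOf_iff.1 (mem_coneOf_join_of_mem_pointSpan (fun i _ => hx i) h0 ?_)).2
    rw [hsum]
    exact Submodule.sum_mem _ fun i _ => (le_iSup (fun i => (x i).submodule) i) (hxz i)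

/-- The cone over the join is the Zariski closure of the image of the product of the cones under
addition. -/
theorem comap_vanishingIdeal_blockProd {ι : Type} [Fintype ι] [Nonempty ι]
    {X : ι → Set (PSpace r)} :
    (vanishingIdeal ℂ (blockProd fun i => affineCone (X i))).comap
      (aeval (sumPoly ι r) : MvPolynomial (Fin (r + 1)) ℂ →ₐ[ℂ] MvPolynomial (ι × Fin (r + 1)) ℂ) =
      vanishingIdeal ℂ (affineCone (join X)) := by
  have hcomp : ∀ (z : ι × Fin (r + 1) → ℂ) (f : MvPolynomial (Fin (r + 1)) ℂ),
      aeval z (aeval (sumPoly ι r) f) = aeval (fun j => ∑ i, z (i, j)) f := fun z f => by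
    rw [comp_aeval_apply]
    simp only [aeval_sumPoly]
  ext f
  rw [Ideal.mem_comap, mem_vanishingIdeal_iff, mem_vanishingIdeal_iff]
  constructor
  · rintro hf v ⟨x, hx, hv⟩
    obtain ⟨c, rfl⟩ := mem_submodule_iff_exists_rep.1 hv
    rw [aeval_smul]
    refine Finset.sum_eq_zero fun d _ => ?_
    rw [mul_eq_zero]
    right
    have hclosed : @IsClosed _ (zariski r) {x | aeval x.rep (homogeneousComponent d f) = 0} := by
      rw [← @isOpen_compl_iff _ _ (zariski r)]
      exact isOpen_zariski_aeval_rep_ne_zero (homogeneousComponent_isHomogeneous d f)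
    refine @closure_minimal _ (zariski r) _ _ ?_ hclosed _ hx
    refine Set.iUnion₂_subset fun p hp y hy => ?_
    obtain ⟨a, ha⟩ := mem_pointSpan_iff.1 (hy (rep_mem_submodule y))
    change aeval y.rep (homogeneousComponent d f) = 0
    refine aeval_homogeneousComponent_eq_zero (fun t => ?_) d
    have := hf (fun k => (t * a k.1) * (p k.1).rep k.2) fun i =>
      ⟨p i, hp i trivial, mem_submodule_iff_exists_rep.2 ⟨t * a i, rfl⟩⟩
    rw [hcomp] at this
    rw [← ha, ← this]
    congr 2
    funext j
    simp [Finset.mul_sum, mul_assoc]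
  · intro hf z hz
    rw [hcomp]
    exact hf _ (sum_mem_affineCone_join hz)

/-! ### Smoothness of a general point -/

/-- A general point of a projective variety is smooth: near a general vector `v` of the cone, the
cone is a product over the line of values of a homogeneous coordinate, and the slice through `v`
where this coordinate is constant is a local parametrization. -/
theorem exists_isSmoothPoint_of_aeval_ne_zero {X : Set (PSpace r)} (hX : IsClosed[zariski r] X)
    (hne : X.Nonempty) (hprime : (vanishingIdeal ℂ (affineCone X)).IsPrime) :
    ∃ G ∉ vanishingIdeal ℂ (affineCone X), ∀ x ∈ X, ∀ v ∈ x.submodule, aeval v G ≠ 0 →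
      IsSmoothPoint X x := by
  have hzero := zeroLocus_vanishingIdeal_affineCone hX hne
  set I := vanishingIdeal ℂ (affineCone X) with hI
  obtain ⟨x₀, hx₀⟩ := hne
  obtain ⟨j, hj⟩ := Function.ne_iff.1 x₀.rep_nonzero
  simp only [Pi.zero_apply] at hj
  have hjI : MvPolynomial.X j ∉ I := fun h => hj (by
    simpa using h x₀.rep ⟨x₀, hx₀, rep_mem_submodule x₀⟩)
  obtain ⟨g, hgI, hg⟩ := exists_local_product_structure I
    (fun _ : Unit => (MvPolynomial.X j : MvPolynomial (Fin (r + 1)) ℂ))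
  refine ⟨g * MvPolynomial.X j, fun h => (hprime.mem_or_mem h).elim hgI hjI, fun x hx v hv hvG => ?_⟩
  rw [map_mul, aeval_X] at hvG
  have hgv := left_ne_zero_of_mul hvG
  have hvj := right_ne_zero_of_mul hvG
  have hv0 : v ≠ 0 := by
    rintro rfl
    exact hvj rfl
  have hvX : v ∈ affineCone X := ⟨x, hx, hv⟩
  obtain ⟨E, _, s, ρ, hs, hρ, hsec, hret⟩ := hg v (by rwa [hzero]) hgv
  rw [hzero] at hsec hret
  simp only [aeval_X] at hs hsec hret
  -- the `j`-th coordinate is not constrained on the cone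
  have hfree : ∀ y : Unit → ℂ, y ∈ zeroLocus ℂ (I.comap (aeval fun _ : Unit =>
      (MvPolynomial.X j : MvPolynomial (Fin (r + 1)) ℂ)) : Ideal (MvPolynomial Unit ℂ)) := by
    intro y p hp
    have h1 := hp ((y () / x₀.rep j) • x₀.rep)
      (smul_mem_affineCone ⟨x₀, hx₀, rep_mem_submodule x₀⟩ _)
    rw [comp_aeval_apply] at h1
    convert h1 using 2
    congr 1
    funext k
    simp [hj]
  let L : (Fin (Fintype.card E) → ℂ) ≃L[ℂ] (E → ℂ) :=
    (LinearEquiv.funCongrLeft ℂ ℂ (Fintype.equivFin E)).toContinuousLinearEquiv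
  let q : (Fin (Fintype.card E) → ℂ) → (Unit → ℂ) × (E → ℂ) := fun t => (fun _ => v j, ρ v + L t)
  have hq0 : q 0 = (fun _ => v j, ρ v) := by simp [q]
  have hqan : AnalyticAt ℂ q 0 :=
    analyticAt_const.prod (analyticAt_const.add (L.analyticAt 0))
  let φ : (Fin (Fintype.card E) → ℂ) → (Fin (r + 1) → ℂ) := fun t => s (q t)
  have hφan : AnalyticAt ℂ φ 0 := AnalyticAt.comp (by rwa [hq0]) hqan
  have hφ0 : φ 0 = v := by
    change s (q 0) = v
    rw [hq0]
    exact hret.self_of_nhds hvX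
  have hqlim : Tendsto q (𝓝 0) (𝓝 (fun _ => v j, ρ v)) := by
    rw [← hq0]
    exact hqan.continuousAt
  have hφsec : ∀ᶠ t in 𝓝 0, φ t ∈ affineCone X ∧ φ t j = v j ∧ ρ (φ t) = ρ v + L t := by
    filter_upwards [hqlim.eventually hsec] with t ht
    obtain ⟨h1, h2, h3⟩ := ht (hfree _)
    exact ⟨h1, h2 (), h3⟩
  refine ⟨Fintype.card E, φ, hφan, ⟨by rwa [hφ0], ?_⟩, ?_, ?_, ?_⟩
  · have := eq_mk_of_mem_submodule hv0 hv
    simpa only [hφ0] using this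
  · intro u hu
    obtain ⟨c, hc⟩ := Submodule.mem_span_singleton.1 hu
    rw [hφ0] at hc
    have hd : HasFDerivAt φ (fderiv ℂ φ 0) 0 := hφan.differentiableAt.hasFDerivAt
    have hdj : HasFDerivAt (fun t => φ t j)
        ((ContinuousLinearMap.proj j : (Fin (r + 1) → ℂ) →L[ℂ] ℂ).comp (fderiv ℂ φ 0)) 0 :=
      (ContinuousLinearMap.proj j : (Fin (r + 1) → ℂ) →L[ℂ] ℂ).hasFDerivAt.comp 0 hd
    have hdj' : HasFDerivAt (fun t => φ t j) (0 : (Fin (Fintype.card E) → ℂ) →L[ℂ] ℂ) 0 :=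
      (hasFDerivAt_const (v j) 0).congr_of_eventuallyEq (hφsec.mono fun t ht => ht.2.1)
    have h1 : fderiv ℂ φ 0 u j = 0 := congrArg (fun T => T u) (hdj.unique hdj')
    have hc0 : c = 0 := by
      rw [← hc] at h1
      simpa [hvj] using h1
    rw [hc0, zero_smul] at hc
    have hρφ : HasFDerivAt (fun t => ρ (φ t)) ((fderiv ℂ ρ v).comp (fderiv ℂ φ 0)) 0 := by
      have : HasFDerivAt ρ (fderiv ℂ ρ v) (φ 0) := by
        rw [hφ0]
        exact hρ.differentiableAt.hasFDerivAt
      exact this.comp 0 hd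
    have hρφ' : HasFDerivAt (fun t => ρ (φ t))
        (L : (Fin (Fintype.card E) → ℂ) →L[ℂ] (E → ℂ)) 0 :=
      (L.hasFDerivAt.const_add (ρ v)).congr_of_eventuallyEq (hφsec.mono fun t ht => ht.2.2)
    have h2 : fderiv ℂ ρ v (fderiv ℂ φ 0 u) = L u := congrArg (fun T => T u) (hρφ.unique hρφ')
    rw [← hc, map_zero] at h2
    exact (map_eq_zero_iff L L.injective).1 h2.symm
  · filter_upwards [hφsec] with t ht
    refine mem_coneOf_iff.2 ⟨fun h => hvj ?_, ht.1⟩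
    rw [← ht.2.1, h, Pi.zero_apply]
  · intro U hU
    rw [hφ0]
    -- rescale to the `j`-th coordinate of `v`
    have hscale : Tendsto (fun w : Fin (r + 1) → ℂ => (v j / w j) • w) (𝓝 v) (𝓝 v) := by
      have : ContinuousAt (fun w : Fin (r + 1) → ℂ => (v j / w j) • w) v :=
        (continuousAt_const.div (continuous_apply j).continuousAt hvj).smul continuousAt_id
      simpa [ContinuousAt, hvj] using this
    have ht : Tendsto (fun w : Fin (r + 1) → ℂ => L.symm (ρ ((v j / w j) • w) - ρ v)) (𝓝 v)
        (𝓝 0) := by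
      have h1 := (hρ.continuousAt.tendsto.comp hscale).sub_const (ρ v)
      rw [sub_self] at h1
      have h2 := (L.symm.continuous.tendsto 0).comp h1
      rwa [map_zero] at h2
    have hwj : ∀ᶠ w : Fin (r + 1) → ℂ in 𝓝 v, w j ≠ 0 :=
      (continuous_apply j).continuousAt.eventually_ne hvj
    filter_upwards [ht.eventually hU, hscale.eventually hret, hwj] with w hwU hw hwj hwX
    refine ⟨_, hwU, w j / v j, ?_⟩
    have h1 := hw (smul_mem_affineCone (mem_coneOf_iff.1 hwX).2 _)
    have h2 : φ (L.symm (ρ ((v j / w j) • w) - ρ v)) = (v j / w j) • w := by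
      have h3 : (fun _ : Unit => ((v j / w j) • w) j) = fun _ => v j := by
        simp [hwj]
      rw [h3] at h1
      change s (fun _ => v j, ρ v + L (L.symm (ρ ((v j / w j) • w) - ρ v))) = _
      rw [L.apply_symm_apply, add_sub_cancel, h1]
    rw [h2, smul_smul, div_mul_div_cancel₀ hvj, div_self hwj, one_smul]

/-! ### Osculating spaces of a join -/

theorem IsLocalParametrization.exists_eq_smul {X : Set (PSpace r)} {x : PSpace r} {n : ℕ}
    {φ : (Fin n → ℂ) → (Fin (r + 1) → ℂ)} (hφ : IsLocalParametrization X x n φ)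
    {v : Fin (r + 1) → ℂ} (hv0 : v ≠ 0) (hv : v ∈ x.submodule) : ∃ a : ℂ, a ≠ 0 ∧ v = a • φ 0 := by
  obtain ⟨h0, rfl⟩ := hφ.center
  rw [Projectivization.submodule_mk, Submodule.mem_span_singleton] at hv
  obtain ⟨a, rfl⟩ := hv
  exact ⟨a, fun ha => hv0 (by rw [ha, zero_smul]), rfl⟩

theorem apply_zero_mem_derivSpan {n : ℕ} (m : ℕ) (φ : (Fin n → ℂ) → (Fin (r + 1) → ℂ)) :
    φ 0 ∈ derivSpan m φ :=
  Submodule.subset_span ⟨0, Nat.zero_le m, Fin.elim0, by simp⟩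

theorem sum_sub_add_mem_affineCone_join {ι : Type} [Fintype ι] {X : ι → Set (PSpace r)}
    {z : ι × Fin (r + 1) → ℂ} (hz : z ∈ blockProd fun i => affineCone (X i)) (i : ι)
    {u : Fin (r + 1) → ℂ} (hu : u ∈ affineCone (X i)) :
    (fun j => ∑ i, z (i, j)) - (fun j => z (i, j)) + u ∈ affineCone (join X) := by
  classical
  have : Nonempty ι := ⟨i⟩
  convert sum_mem_affineCone_join (X := X) (z := fun k => if k.1 = i then u k.2 else z k)
    fun i' => ?_ using 1
  · funext j
    have h : ∑ i', ((if i' = i then u j else z (i', j)) - z (i', j)) = u j - z (i, j) := by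
      rw [Finset.sum_eq_single i] <;> simp +contextual
    rw [Finset.sum_sub_distrib] at h
    simp only [Pi.add_apply, Pi.sub_apply]
    linear_combination -h
  · by_cases h : i' = i
    · subst h
      simpa using hu
    · simpa [h] using hz i'

section Osculation

variable {ι : Type} [Fintype ι] {X : ι → Set (PSpace r)} {z : ι × Fin (r + 1) → ℂ}
  {q : PSpace r} {p : ι → PSpace r} {m n : ℕ} {φ : (Fin n → ℂ) → (Fin (r + 1) → ℂ)}
  {k : ι → ℕ} {ψ : ∀ i, (Fin (k i) → ℂ) → (Fin (r + 1) → ℂ)}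

/-- Terracini's inclusion: the join contains all translates `w - zᵢ + u` with `u` in the cone over
`Xᵢ`, so its osculating space contains those of the `Xᵢ`. -/
theorem iSup_derivSpan_le (hm : 1 ≤ m ∨ Subsingleton ι)
    (hz : z ∈ blockProd fun i => affineCone (X i)) (hz0 : ∀ i, (fun j => z (i, j)) ≠ 0)
    (hzp : ∀ i, (fun j => z (i, j)) ∈ (p i).submodule)
    (hw0 : (fun j => ∑ i, z (i, j)) ≠ 0) (hwq : (fun j => ∑ i, z (i, j)) ∈ q.submodule)
    (hφ : IsLocalParametrization (join X) q n φ)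
    (hψ : ∀ i, IsLocalParametrization (X i) (p i) (k i) (ψ i)) :
    ⨆ i, derivSpan m (ψ i) ≤ derivSpan m φ := by
  refine iSup_le fun i => le_of_forall_clm fun l hl => ?_
  set w := fun j => ∑ i, z (i, j) with hw
  obtain ⟨α, hα, hwα⟩ := hφ.exists_eq_smul hw0 hwq
  obtain ⟨a, ha, hza⟩ := (hψ i).exists_eq_smul (hz0 i) (hzp i)
  have hlw : l w = 0 := by
    rw [hwα, map_smul, hl _ (apply_zero_mem_derivSpan m φ), smul_zero]
  have key : ∀ {k : ℕ} (u : (Fin k → ℂ) → (Fin (r + 1) → ℂ)), DifferentiableAt ℂ u 0 →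
      u 0 = (fun j => z (i, j)) → (∀ᶠ t in 𝓝 0, u t ∈ affineCone (X i)) →
      (fun t => l (w - (fun j => z (i, j)) + u t)) =O[𝓝 0] fun t => ‖t‖ ^ (m + 1) := by
    intro k u hu hu0 hmem
    have hd : DifferentiableAt ℂ (fun t => w - (fun j => z (i, j)) + u t) 0 := hu.const_add _
    have h0 : w - (fun j => z (i, j)) + u 0 = w := by rw [hu0, sub_add_cancel]
    refine hφ.isBigO_of_mem_coneOf hd hα (by rw [h0, hwα]) ?_ l
      ((forall_derivSpan_eq_zero_iff m hφ.analyticAt l).1 hl)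
    filter_upwards [hmem, hd.continuousAt.eventually_ne (y := 0) (by rwa [h0])] with t ht ht0
    exact mem_coneOf_iff.2 ⟨ht0, sum_sub_add_mem_affineCone_join hz i ht⟩
  have hlz : l (fun j => z (i, j)) = 0 := by
    rcases hm with hm | hm
    · -- moving `zᵢ` along its own line shows that the tangent cone of the join contains `zᵢ`
      have h1 := key (k := 1) (fun t => (1 + t 0) • fun j => z (i, j)) (by fun_prop) (by simp)
        (.of_forall fun t => smul_mem_affineCone (hz i) _)
      have h2 : (fun t : Fin 1 → ℂ => l (w - (fun j => z (i, j)) +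
          (1 + t 0) • fun j => z (i, j))) =
          ⇑(l (fun j => z (i, j)) • ContinuousLinearMap.proj (R := ℂ) (φ := fun _ : Fin 1 => ℂ) 0) := by
        funext t
        simp only [map_add, map_sub, map_smul, hlw, smul_eq_mul, FunLike.coe_smul,
          Pi.smul_apply, ContinuousLinearMap.proj_apply]
        ring
      rw [h2, isBigO_pow_iff_iteratedFDeriv_eq_zero (ContinuousLinearMap.analyticAt _ _)] at h1
      have h3 := congrArg (fun M => M fun _ => fun _ => (1 : ℂ)) (h1 1 hm)
      rw [iteratedFDeriv_one_apply, ContinuousLinearMap.fderiv] at h3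
      simpa using h3
    · rw [← hlw, hw]
      congr 1
      funext j
      rw [Fintype.sum_subsingleton _ i]
  refine (forall_derivSpan_eq_zero_iff m (hψ i).analyticAt l).2 ?_
  have h1 := key (fun t => a • ψ i t) ((hψ i).analyticAt.differentiableAt.const_smul a) hza.symm
    ((hψ i).mem.mono fun t ht => smul_mem_affineCone (mem_coneOf_iff.1 ht).2 a)
  have h2 := h1.const_mul_left a⁻¹
  refine h2.congr_left fun t => ?_
  rw [map_add, map_sub, hlw, hlz, map_smul, smul_eq_mul, sub_zero, zero_add, inv_mul_cancel_left₀ ha]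

/-- If addition of vectors, from the product of the cones over the `Xᵢ` to the cone over the join,
has an analytic local section `S` through `z`, then the osculating space of the join is contained
in the span of those of the `Xᵢ`: a lifted parametrization of the join is a sum of curved families
in the cones over the `Xᵢ`. -/
theorem derivSpan_le_iSup (hz0 : ∀ i, (fun j => z (i, j)) ≠ 0)
    (hzp : ∀ i, (fun j => z (i, j)) ∈ (p i).submodule)
    (hw0 : (fun j => ∑ i, z (i, j)) ≠ 0) (hwq : (fun j => ∑ i, z (i, j)) ∈ q.submodule)
    {S : (Fin (r + 1) → ℂ) → (ι × Fin (r + 1) → ℂ)}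
    (hSan : AnalyticAt ℂ S fun j => ∑ i, z (i, j)) (hSz : S (fun j => ∑ i, z (i, j)) = z)
    (hS : ∀ᶠ x in 𝓝 fun j => ∑ i, z (i, j), x ∈ affineCone (join X) →
      (S x ∈ blockProd fun i => affineCone (X i)) ∧ ∀ j, ∑ i, S x (i, j) = x j)
    (hφ : IsLocalParametrization (join X) q n φ)
    (hψ : ∀ i, IsLocalParametrization (X i) (p i) (k i) (ψ i)) :
    derivSpan m φ ≤ ⨆ i, derivSpan m (ψ i) := by
  refine le_of_forall_clm fun l hl => ?_
  set w := fun j => ∑ i, z (i, j) with hw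
  obtain ⟨α, hα, hwα⟩ := hφ.exists_eq_smul hw0 hwq
  have hx0 : α • φ 0 = w := hwα.symm
  have hxan : AnalyticAt ℂ (fun t => α • φ t) 0 := analyticAt_const.fun_smul hφ.analyticAt
  have hxlim : Tendsto (fun t => α • φ t) (𝓝 0) (𝓝 w) := by
    have := hxan.continuousAt.tendsto
    rwa [hx0] at this
  have hSx : AnalyticAt ℂ (fun t => S (α • φ t)) 0 := by
    refine AnalyticAt.fun_comp (g := S) ?_ hxan
    rwa [hx0]
  have hmem := (hxlim.eventually hS).and hφ.mem
  have hterm : ∀ i, (fun t => l (fun j => S (α • φ t) (i, j))) =O[𝓝 0] fun t => ‖t‖ ^ (m + 1) := by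
    intro i
    obtain ⟨a, ha, hza⟩ := (hψ i).exists_eq_smul (hz0 i) (hzp i)
    have hd : DifferentiableAt ℂ (fun t => fun j => S (α • φ t) (i, j)) 0 :=
      differentiableAt_pi.2 fun j => differentiableAt_pi.1 hSx.differentiableAt (i, j)
    have h0 : (fun j => S (α • φ 0) (i, j)) = fun j => z (i, j) := by rw [hx0, hSz]
    refine (hψ i).isBigO_of_mem_coneOf hd ha (h0.trans hza) ?_ l
      ((forall_derivSpan_eq_zero_iff m (hψ i).analyticAt l).1 fun v hv =>
        hl v (le_iSup (fun i => derivSpan m (ψ i)) i hv))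
    filter_upwards [hmem, hd.continuousAt.eventually_ne (y := 0) (by rw [h0]; exact hz0 i)]
      with t ht ht0
    exact mem_coneOf_iff.2
      ⟨ht0, (ht.1 (smul_mem_affineCone (mem_coneOf_iff.1 ht.2).2 α)).1 i⟩
  refine (forall_derivSpan_eq_zero_iff m hφ.analyticAt l).2 ?_
  have hsum := (Asymptotics.IsBigO.sum (s := Finset.univ) fun i _ => hterm i).const_mul_left α⁻¹
  refine hsum.congr' (hmem.mono fun t ht => ?_) .rfl
  have h1 : ∑ i, (fun j => S (α • φ t) (i, j)) = α • φ t := by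
    funext j
    rw [Finset.sum_apply]
    exact (ht.1 (smul_mem_affineCone (mem_coneOf_iff.1 ht.2).2 α)).2 j
  simp only [Finset.sum_apply]
  rw [← map_sum, h1, map_smul, smul_eq_mul, inv_mul_cancel_left₀ hα]

end Osculation

/-! ### General points and general decompositions -/

/-- A linear map has a linear section over its range with a prescribed value at one point. -/
theorem exists_linear_section {E : Type*} [AddCommGroup E] [Module ℂ E]
    (A : E →ₗ[ℂ] (Fin (r + 1) → ℂ)) {a₀ : E} (h₀ : A a₀ ≠ 0) :
    ∃ T : (Fin (r + 1) → ℂ) →ₗ[ℂ] E, T (A a₀) = a₀ ∧ ∀ a, A (T (A a)) = A a := by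
  obtain ⟨j, hj⟩ := Function.ne_iff.1 h₀
  obtain ⟨R, hR⟩ := A.rangeRestrict.exists_rightInverse_of_surjective A.range_rangeRestrict
  obtain ⟨T₀, hT₀⟩ := R.exists_extend
  have h1 : ∀ a, A (T₀ (A a)) = A a := fun a => by
    have h2 : T₀ (A a) = R (A.rangeRestrict a) := by
      rw [← hT₀]; rfl
    rw [h2]
    exact congrArg Subtype.val (LinearMap.congr_fun hR (A.rangeRestrict a))
  refine ⟨T₀ + (((A a₀ j)⁻¹ • LinearMap.proj j).smulRight (a₀ - T₀ (A a₀))), ?_, fun a => ?_⟩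
  · have : A a₀ j ≠ 0 := hj
    simp [this]
  · simp [h1]

theorem exists_aeval_mul_ne_zero {τ : Type*} {f g : MvPolynomial τ ℂ} (hf : f ≠ 0) (hg : g ≠ 0) :
    ∃ a : τ → ℂ, aeval a f ≠ 0 ∧ aeval a g ≠ 0 := by
  by_contra! h
  refine mul_ne_zero hf hg (MvPolynomial.funext fun a => ?_)
  rw [map_mul, map_zero, mul_eq_zero, or_iff_not_imp_left]
  exact h a

/-- A polynomial condition on the summands that is satisfiable for one decomposition of one vector
in the span of the `pᵢ` is satisfiable for suitable decompositions of representatives of all points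
of the span in a nonempty Zariski open subset. -/
theorem exists_isOpen_forall_decomposition {ι : Type} [Fintype ι] [Nonempty ι] (p : ι → PSpace r)
    {G : MvPolynomial (ι × Fin (r + 1)) ℂ} {a₁ : ι → ℂ}
    (hG : aeval (fun k => a₁ k.1 * (p k.1).rep k.2) G ≠ 0) :
    ∃ V : Set (PSpace r), IsOpen[zariski r] V ∧ (V ∩ projPoints (pointSpan p)).Nonempty ∧
      ∀ q ∈ V ∩ projPoints (pointSpan p), ∃ z : ι × Fin (r + 1) → ℂ,
        (∀ i, (fun j => z (i, j)) ∈ (p i).submodule) ∧ (∀ i, (fun j => z (i, j)) ≠ 0) ∧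
        (fun j => ∑ i, z (i, j)) ≠ 0 ∧ (fun j => ∑ i, z (i, j)) ∈ q.submodule ∧
        aeval z G ≠ 0 := by
  let Γ : MvPolynomial ι ℂ := aeval (fun k : ι × Fin (r + 1) => X k.1 * C ((p k.1).rep k.2)) G
  have hΓ : ∀ a, aeval a Γ = aeval (fun k => a k.1 * (p k.1).rep k.2) G := fun a => by
    rw [comp_aeval_apply]
    simp
  -- the second factor makes all coefficients, and so all summands, nonzero
  let Q : MvPolynomial ι ℂ := Γ * ∏ i, X i
  have hQ : ∀ a, aeval a Q = aeval (fun k => a k.1 * (p k.1).rep k.2) G * ∏ i, a i := fun a => by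
    rw [map_mul, hΓ, map_prod]
    simp
  have hQ0 : Q ≠ 0 := by
    refine mul_ne_zero (fun h => hG ?_) (Finset.prod_ne_zero_iff.2 fun i _ => X_ne_zero i)
    rw [← hΓ, h, map_zero]
  obtain ⟨e, he⟩ : ∃ e, homogeneousComponent e Q ≠ 0 := by
    by_contra! h
    exact hQ0 (by rw [← sum_homogeneousComponent Q, Finset.sum_eq_zero fun d _ => h d])
  let A : (ι → ℂ) →ₗ[ℂ] (Fin (r + 1) → ℂ) := Fintype.linearCombination ℂ fun i => (p i).rep
  have hA : ∀ a, A a = ∑ i, a i • (p i).rep := fun a => rfl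
  have hspan : ∀ v, v ∈ pointSpan p ↔ ∃ a, A a = v := fun v => mem_pointSpan_iff
  -- a value `a₀` of the coefficients at which the component does not vanish and `A a₀ ≠ 0`
  obtain ⟨a₀, ha₀, hA₀⟩ : ∃ a₀, aeval a₀ (homogeneousComponent e Q) ≠ 0 ∧ A a₀ ≠ 0 := by
    classical
    let i : ι := Classical.arbitrary ι
    obtain ⟨j, hj⟩ := Function.ne_iff.1 (p i).rep_nonzero
    let Λ : MvPolynomial ι ℂ := ∑ i, C ((p i).rep j) * X i
    have hΛ : ∀ a, aeval a Λ = A a j := fun a => by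
      simp [Λ, hA, mul_comm]
    have hΛ0 : Λ ≠ 0 := fun h => hj (by
      have := hΛ (Pi.single i 1)
      rw [h, map_zero, hA, Finset.sum_apply, Finset.sum_eq_single i (by simp +contextual)
        (by simp)] at this
      simpa using this.symm)
    obtain ⟨a, ha, ha'⟩ := exists_aeval_mul_ne_zero he hΛ0
    exact ⟨a, ha, fun h => ha' (by rw [hΛ, h, Pi.zero_apply])⟩
  obtain ⟨T, hT₀, hT⟩ := exists_linear_section A hA₀
  -- the component of degree `e`, transported to the span along the section `T`
  let F : MvPolynomial (Fin (r + 1)) ℂ :=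
    aeval (fun i => ∑ j, C (T (fun j' => if j = j' then 1 else 0) i) * X j) (homogeneousComponent e Q)
  have hF : ∀ y, aeval y F = aeval (T y) (homogeneousComponent e Q) := fun y => by
    rw [comp_aeval_apply]
    congr 2
    funext i
    conv_rhs => rw [LinearMap.pi_apply_eq_sum_univ T y, Finset.sum_apply]
    simp [mul_comm]
  have hFhom : F.IsHomogeneous e := by
    have := (homogeneousComponent_isHomogeneous e Q).aeval
      (fun i => ∑ j, C (T (fun j' => if j = j' then 1 else 0) i) * X j) (n := 1) fun i =>
        IsHomogeneous.sum _ _ _ fun j _ => by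
          simpa using (isHomogeneous_C _ _).mul (isHomogeneous_X ℂ j)
    rwa [one_mul] at this
  refine ⟨{y | aeval y.rep F ≠ 0}, isOpen_zariski_aeval_rep_ne_zero hFhom,
    ⟨Projectivization.mk ℂ (A a₀) hA₀, ?_, ?_⟩, ?_⟩
  · obtain ⟨c, hc⟩ := mem_submodule_iff_exists_rep.1 (mem_submodule_mk hA₀)
    intro h
    refine ha₀ ?_
    rw [← hT₀, ← hF, ← hc, aeval_smul_of_isHomogeneous hFhom, h, mul_zero]
  · change Projectivization.submodule _ ≤ _
    rw [Projectivization.submodule_mk, Submodule.span_singleton_le_iff_mem]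
    exact (hspan _).2 ⟨a₀, rfl⟩
  · rintro q ⟨hqV, hq⟩
    obtain ⟨b, hb⟩ := (hspan _).1 (hq (rep_mem_submodule q))
    have hTq : A (T q.rep) = q.rep := by rw [← hb, hT]
    obtain ⟨t, ht⟩ : ∃ t : ℂ, aeval (t • T q.rep) Q ≠ 0 := by
      by_contra! h
      exact hqV ((hF _).trans (aeval_homogeneousComponent_eq_zero h e))
    rw [hQ] at ht
    have hi : ∀ i, (t • T q.rep) i ≠ 0 := fun i =>
      Finset.prod_ne_zero_iff.1 (right_ne_zero_of_mul ht) i (Finset.mem_univ i)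
    have ht0 : t ≠ 0 := fun h => hi (Classical.arbitrary ι) (by simp [h])
    have hsum : (fun j => ∑ i, (t • T q.rep) i * (p i).rep j) = t • q.rep := by
      funext j
      have h1 := congrFun hTq j
      rw [hA, Finset.sum_apply] at h1
      rw [Pi.smul_apply, ← h1, Finset.smul_sum]
      simp [mul_assoc]
    refine ⟨fun k => (t • T q.rep) k.1 * (p k.1).rep k.2,
      fun i => mem_submodule_iff_exists_rep.2 ⟨(t • T q.rep) i, rfl⟩,
      fun i => smul_ne_zero (hi i) (p i).rep_nonzero, ?_, ?_, left_ne_zero_of_mul ht⟩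
    · exact hsum ▸ smul_ne_zero ht0 q.rep_nonzero
    · exact hsum ▸ Submodule.smul_mem _ t (rep_mem_submodule q)

/-- If a polynomial does not vanish identically on the product of the cones, then for general `pᵢ`
and general `q` in their span it does not vanish at some decomposition `∑ zᵢ` of a representative
of `q` into nonzero multiples of the `pᵢ`. -/
theorem exists_generic_decomposition {ι : Type} [Fintype ι] [DecidableEq ι] [Nonempty ι]
    {X : ι → Set (PSpace r)} {G : MvPolynomial (ι × Fin (r + 1)) ℂ}
    (hG : G ∉ vanishingIdeal ℂ (blockProd fun i => affineCone (X i))) :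
    ∃ U : Set (ι → PSpace r), IsOpen[multiZariski ι r] U ∧ (U ∩ Set.univ.pi X).Nonempty ∧
      ∀ p ∈ U ∩ Set.univ.pi X, ∃ V : Set (PSpace r), IsOpen[zariski r] V ∧
        (V ∩ projPoints (pointSpan p)).Nonempty ∧
        ∀ q ∈ V ∩ projPoints (pointSpan p), ∃ z : ι × Fin (r + 1) → ℂ,
          (∀ i, (fun j => z (i, j)) ∈ (p i).submodule) ∧ (∀ i, (fun j => z (i, j)) ≠ 0) ∧
          (fun j => ∑ i, z (i, j)) ≠ 0 ∧ (fun j => ∑ i, z (i, j)) ∈ q.submodule ∧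
          aeval z G ≠ 0 := by
  simp only [mem_vanishingIdeal_iff, not_forall] at hG
  obtain ⟨z, hz, hzG⟩ := hG
  choose x hx hxz using hz
  choose a ha using fun i => mem_submodule_iff_exists_rep.1 (hxz i)
  have hza : z = fun k => a k.1 * (x k.1).rep k.2 := by
    funext k
    exact (congrFun (ha k.1) k.2).symm
  rw [hza, aeval_mul_eq_sum] at hzG
  obtain ⟨d, -, hd⟩ := Finset.exists_ne_zero_of_sum_ne_zero hzG
  refine ⟨{p | aeval (fun k : ι × Fin (r + 1) => (p k.1).rep k.2) (weightedHomogeneousComponent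
    (fun k : ι × Fin (r + 1) => (Pi.single k.1 1 : ι → ℕ)) d G) ≠ 0},
    TopologicalSpace.isOpen_generateFrom_of_mem
      ⟨d, _, weightedHomogeneousComponent_isWeightedHomogeneous d G, rfl⟩,
    ⟨x, right_ne_zero_of_mul hd, fun i _ => hx i⟩, ?_⟩
  rintro p ⟨hp, -⟩
  obtain ⟨a₁, ha₁⟩ : ∃ a₁ : ι → ℂ, aeval (fun k => a₁ k.1 * (p k.1).rep k.2) G ≠ 0 := by
    by_contra! h
    exact hp (aeval_multihomogeneousComponent_eq_zero (v := fun k => (p k.1).rep k.2) h d)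
  exact exists_isOpen_forall_decomposition p ha₁

/-! ### The general point of a join -/

theorem IsNondegenerateVariety.isPrime_vanishingIdeal_blockProd {ι : Type} [Fintype ι]
    {X : ι → Set (PSpace r)} (hX : ∀ i, IsNondegenerateVariety (X i)) :
    (vanishingIdeal ℂ (blockProd fun i => affineCone (X i))).IsPrime :=
  Join.isPrime_vanishingIdeal_blockProd (fun i => affineCone_nonempty (hX i).isIrreducible.1)
    fun i => isPrime_vanishingIdeal_affineCone (hX i).isIrreducible

/-- At a family `z` of vectors outside a proper closed subset of the product of the cones, the join
and the `Xᵢ` are smooth and addition has an analytic local section. -/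
theorem exists_polynomial_smooth_and_section {ι : Type} [Fintype ι] [Nonempty ι]
    {X : ι → Set (PSpace r)} (hX : ∀ i, IsNondegenerateVariety (X i)) :
    ∃ G ∉ vanishingIdeal ℂ (blockProd fun i => affineCone (X i)),
      ∀ z ∈ blockProd fun i => affineCone (X i), aeval z G ≠ 0 →
        (∀ q ∈ join X, (fun j => ∑ i, z (i, j)) ∈ q.submodule → IsSmoothPoint (join X) q) ∧
        (∀ i, ∀ x ∈ X i, (fun j => z (i, j)) ∈ x.submodule → IsSmoothPoint (X i) x) ∧
        ∃ S : (Fin (r + 1) → ℂ) → (ι × Fin (r + 1) → ℂ),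
          AnalyticAt ℂ S (fun j => ∑ i, z (i, j)) ∧ S (fun j => ∑ i, z (i, j)) = z ∧
          ∀ᶠ x in 𝓝 fun j => ∑ i, z (i, j), x ∈ affineCone (join X) →
            (S x ∈ blockProd fun i => affineCone (X i)) ∧ ∀ j, ∑ i, S x (i, j) = x j := by
  classical
  have hI := IsNondegenerateVariety.isPrime_vanishingIdeal_blockProd hX
  have hne : ∀ i, (X i).Nonempty := fun i => (hX i).isIrreducible.1
  have hJne := join_nonempty hne
  have hJcl : IsClosed[zariski r] (join X) := @isClosed_closure _ (zariski r) _
  have hcomap := comap_vanishingIdeal_blockProd (X := X)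
  have hJ : (vanishingIdeal ℂ (affineCone (join X))).IsPrime :=
    hcomap ▸ Ideal.comap_isPrime _ _
  obtain ⟨g, hg, hsec⟩ := exists_local_product_structure
    (vanishingIdeal ℂ (blockProd fun i => affineCone (X i))) (sumPoly ι r)
  obtain ⟨GJ, hGJ, hJs⟩ := exists_isSmoothPoint_of_aeval_ne_zero hJcl hJne hJ
  choose GX hGX hXs using fun i => exists_isSmoothPoint_of_aeval_ne_zero (hX i).isClosed (hne i)
    (isPrime_vanishingIdeal_affineCone (hX i).isIrreducible)
  have hev : ∀ (z : ι × Fin (r + 1) → ℂ) (f : MvPolynomial (Fin (r + 1)) ℂ),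
      aeval z (aeval (sumPoly ι r) f) = aeval (fun j => ∑ i, z (i, j)) f := fun z f => by
    rw [comp_aeval_apply]
    simp only [aeval_sumPoly]
  refine ⟨g * (aeval (sumPoly ι r) GJ * ∏ i, rename (fun j => (i, j)) (GX i)), ?_, ?_⟩
  · refine hI.mul_notMem hg (hI.mul_notMem ?_ ?_)
    · rw [← hcomap, Ideal.mem_comap] at hGJ
      exact hGJ
    · rw [hI.prod_mem_iff]
      rintro ⟨i, -, hi⟩
      refine hGX i fun v hv => ?_
      choose x hx using hne
      have := hi (fun k => if k.1 = i then v k.2 else (x k.1).rep k.2) fun i' => by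
        by_cases h : i' = i
        · subst h
          simpa using hv
        · simpa [h] using ⟨x i', hx i', rep_mem_submodule (x i')⟩
      rw [aeval_rename] at this
      simpa [Function.comp_def] using this
  · intro z hz hzG
    rw [map_mul, map_mul, map_prod, hev] at hzG
    refine ⟨fun q hq hzq => hJs q hq _ hzq (left_ne_zero_of_mul (right_ne_zero_of_mul hzG)),
      fun i x hx hzx => hXs i x hx _ hzx ?_, ?_⟩
    · have := Finset.prod_ne_zero_iff.1 (right_ne_zero_of_mul (right_ne_zero_of_mul hzG)) i
        (Finset.mem_univ i)
      rwa [aeval_rename] at this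
    have hzero := zeroLocus_vanishingIdeal_blockProd fun i =>
      zeroLocus_vanishingIdeal_affineCone (hX i).isClosed (hne i)
    rw [hcomap, zeroLocus_vanishingIdeal_affineCone hJcl hJne, hzero] at hsec
    obtain ⟨E, _, s, ρ, hs, -, hmem, hret⟩ := hsec z hz (left_ne_zero_of_mul hzG)
    simp only [aeval_sumPoly] at hs hmem hret
    -- the section of addition with constant last coordinate `ρ z`
    have hpair : AnalyticAt ℂ (fun x : Fin (r + 1) → ℂ => (x, ρ z)) (fun j => ∑ i, z (i, j)) :=
      analyticAt_id.prod analyticAt_const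
    refine ⟨fun x => s (x, ρ z), AnalyticAt.fun_comp (g := s) hs hpair, hret.self_of_nhds hz, ?_⟩
    filter_upwards [hpair.continuousAt.tendsto.eventually hmem] with x hx hxJ
    exact ⟨(hx hxJ).1, (hx hxJ).2.1⟩

end Join

theorem proposition2p1 (r h m : ℕ) (hm : 1 ≤ m ∨ h = 0)
    (X : Fin (h + 1) → Set (Join.PSpace r)) (hX : ∀ i, Join.IsNondegenerateVariety (X i)) :
    ∃ U : Set (Fin (h + 1) → Join.PSpace r),
      IsOpen[Join.multiZariski (Fin (h + 1)) r] U ∧ (U ∩ Set.univ.pi X).Nonempty ∧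
      ∀ p ∈ U ∩ Set.univ.pi X,
        ∃ V : Set (Join.PSpace r),
          IsOpen[Join.zariski r] V ∧ (V ∩ Join.projPoints (Join.pointSpan p)).Nonempty ∧
          ∀ q ∈ V ∩ Join.projPoints (Join.pointSpan p),
            Join.IsSmoothPoint (Join.join X) q ∧
            (∀ i, Join.IsSmoothPoint (X i) (p i)) ∧
            ∀ (L : Submodule ℂ (Fin (r + 1) → ℂ))
              (M : Fin (h + 1) → Submodule ℂ (Fin (r + 1) → ℂ)),
              Join.IsOsculatingSpace m (Join.join X) q L →
              (∀ i, Join.IsOsculatingSpace m (X i) (p i) (M i)) →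
              L = ⨆ i, M i := by
  obtain ⟨G, hG, hgood⟩ := Join.exists_polynomial_smooth_and_section hX
  obtain ⟨U, hU, hUne, hUV⟩ := Join.exists_generic_decomposition hG
  refine ⟨U, hU, hUne, fun p hp => ?_⟩
  obtain ⟨V, hV, hVne, hq⟩ := hUV p hp
  refine ⟨V, hV, hVne, fun q hqV => ?_⟩
  obtain ⟨z, hzp, hz0, hw0, hwq, hzG⟩ := hq q hqV
  have hz : z ∈ Join.blockProd fun i => Join.affineCone (X i) :=
    fun i => ⟨p i, hp.2 i trivial, hzp i⟩
  have hqJ : q ∈ Join.join X := by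
    obtain ⟨h0, hJ⟩ := Join.mem_coneOf_iff.2 ⟨hw0, Join.sum_mem_affineCone_join hz⟩
    rwa [Join.eq_mk_of_mem_submodule h0 hwq] at hJ
  obtain ⟨hJs, hXs, S, hSan, hSz, hS⟩ := hgood z hz hzG
  refine ⟨hJs q hqJ hwq, fun i => hXs i _ (hp.2 i trivial) (hzp i), ?_⟩
  rintro L M ⟨n, φ, hφ, rfl⟩ hM
  choose k ψ hψ hMψ using hM
  obtain rfl : M = fun i => Join.derivSpan m (ψ i) := funext hMψ
  have hm' : 1 ≤ m ∨ Subsingleton (Fin (h + 1)) := hm.imp_right fun hh => by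
    subst hh
    exact inferInstanceAs (Subsingleton (Fin 1))
  exact le_antisymm (Join.derivSpan_le_iSup hz0 hzp hw0 hwq hSan hSz hS hφ hψ)
    (Join.iSup_derivSpan_le hm' hz hz0 hzp hw0 hwq hφ hψ)
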